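/- Let $n\ge 1$. A partition of the $2n$ points $1,\dots,n$ (upper row) and $1',\dots,n'$ (lower row) is an equivalence relation on these points; its classes are called blocks. The partition monoid $\mathcal P_n$ consists of all of them. The product $\alpha\beta$ is obtained by stacking $\alpha$ on top of $\beta$, identifying the lower row of $\alpha$ with the upper row of $\beta$, forming connected components, and deleting the middle row; $m(\alpha,\beta)$ denotes the number of connected components contained in the middle row. The rank of $\alpha$ is the number of its blocks that meet both rows. The Jones monoid $\mathcal J_n$ is the submonoid of all partitions whose blocks all have size $2$ and which can be drawn without crossings in the rectangle between the two rows. Put $I_r(\mathcal J_n)=\{\alpha\in\mathcal J_n:\operatorname{rank}(\alpha)\le r\}$, and let $\operatorname{rank}(I_r(\mathcal J_n))$ be the least size of a set generating $I_r(\mathcal J_n)$ as a semigroup. For $\delta\in\mathbb C$ let $\psi(\alpha,\beta)=\delta^{m(\alpha,\beta)}$ (with $0^0=1$), and let the Temperley--Lieb algebra $\mathbb C^\psi[\mathcal J_n]$ be the complex vector space with basis $\mathcal J_n$ and product $\alpha\star\beta=\psi(\alpha,\beta)\,\alpha\beta$. If $\mathbb C^\psi[\mathcal J_n]$ is semisimple,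 then its irreducible left modules are, up to isomorphism and without repetition, modules $J_n^r$ indexed by the set $$\hat J_n=\{r\in\mathbb Z_{\ge 0} : r=n-2k \text{ for some integer } k\ge 0\},$$ where $J_n^r$ belongs to the diagrams of rank $r$ in the sense that every $\alpha\in\mathcal J_n$ of rank less than $r$ acts on $J_n^r$ as zero while some $\alpha\in\mathcal J_n$ of rank $r$ does not. Moreover, for $0\le r=n-2k\le n-2$, $$\dim_{\mathbb C}(J_n^r)=\operatorname{rank}(I_r(\mathcal J_n))=\frac{r+1}{n+1}\binom{n+1}{k}.$$ -/

import Mathlib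

namespace Diagram

section Rows
variable {A B C D : Type*}

/-- Inclusion of the upper two of three rows. -/
def upper : A ⊕ B → A ⊕ B ⊕ C := Sum.elim Sum.inl (fun b => Sum.inr (Sum.inl b))

/-- Inclusion of the lower two of three rows. -/
def lower : B ⊕ C → A ⊕ B ⊕ C := Sum.inr

/-- Inclusion of the outer two of three rows. -/
def outer : A ⊕ C → A ⊕ B ⊕ C := Sum.elim Sum.inl (fun c => Sum.inr (Sum.inr c))

/-- Inclusion of the middle one of three rows. -/
def mid : B → A ⊕ B ⊕ C := fun b => Sum.inr (Sum.inl b)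

/-- The connected components of the graph obtained by stacking `α` on top of `β`. -/
def stack (α : Setoid (A ⊕ B)) (β : Setoid (B ⊕ C)) : Setoid (A ⊕ B ⊕ C) :=
  Setoid.map α upper ⊔ Setoid.map β lower

/-- The composite: stack the two diagrams and delete the middle row. -/
def comp (α : Setoid (A ⊕ B)) (β : Setoid (B ⊕ C)) : Setoid (A ⊕ C) :=
  Setoid.comap outer (stack α β)

/-- The number of classes of an equivalence relation that are contained in a given set. -/
noncomputable def classesIn {X : Type*} (r : Setoid X) (U : Set X) : ℕ :=
  {c ∈ r.classes | c ⊆ U}.ncard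

/-- The number of components contained in the middle row of the stacked graph. -/
noncomputable def loops (α : Setoid (A ⊕ B)) (β : Setoid (B ⊕ C)) : ℕ :=
  classesIn (stack α β) (Set.range mid)

end Rows

section Glue

theorem map_le_iff {X Y : Type*} {r : Setoid X} {f : X → Y} {s : Setoid Y} :
    Setoid.map r f ≤ s ↔ ∀ x y, r x y → s (f x) (f y) := by
  constructor
  · intro h x y hxy
    exact h (Relation.EqvGen.rel _ _ ⟨x, y, hxy, rfl, rfl⟩)
  · intro h
    refine Setoid.eqvGen_le ?_
    rintro _ _ ⟨a, b, hab, rfl, rfl⟩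
    exact h a b hab

theorem map_rel {X Y : Type*} (r : Setoid X) (f : X → Y) {x y : X} (h : r x y) :
    Setoid.map r f (f x) (f y) := map_le_iff.1 le_rfl x y h

theorem map_sup {X Y : Type*} (r s : Setoid X) (f : X → Y) :
    Setoid.map (r ⊔ s) f = Setoid.map r f ⊔ Setoid.map s f := by
  apply le_antisymm
  · rw [map_le_iff]
    have : r ⊔ s ≤ Setoid.comap f (Setoid.map r f ⊔ Setoid.map s f) := by
      refine sup_le ?_ ?_
      · intro x y h
        exact (le_sup_left : Setoid.map r f ≤ _) (map_rel r f h)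
      · intro x y h
        exact (le_sup_right : Setoid.map s f ≤ _) (map_rel s f h)
    exact fun x y h => this h
  · refine sup_le ?_ ?_ <;> rw [map_le_iff] <;> intro x y h <;> apply map_rel
    · exact (le_sup_left : r ≤ _) h
    · exact (le_sup_right : s ≤ _) h

theorem map_map {X Y Z : Type*} (r : Setoid X) (f : X → Y) (g : Y → Z) :
    Setoid.map (Setoid.map r f) g = Setoid.map r (g ∘ f) := by
  apply le_antisymm
  · rw [map_le_iff]
    have : Setoid.map r f ≤ Setoid.comap g (Setoid.map r (g ∘ f)) := by
      rw [map_le_iff]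
      intro x y h
      exact map_rel r (g ∘ f) h
    exact fun x y h => this h
  · rw [map_le_iff]
    intro x y h
    exact map_rel _ g (map_rel r f h)

theorem map_iff {X Y : Type*} (r : Setoid X) {f : X → Y} (hf : f.Injective) {x y : Y} :
    Setoid.map r f x y ↔ (∃ a b, r a b ∧ f a = x ∧ f b = y) ∨ x = y := by
  have h := Setoid.coe_map_of_ker_le r f (Setoid.ker_eq_bot_iff.2 hf ▸ bot_le)
  have h2 := congrFun (congrFun h x) y
  simp only [Pi.sup_apply, sup_Prop_eq] at h2
  rw [h2]; rfl

variable {W X Y Z : Type*}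

theorem comap_sup_map (i : Y → X) (r : Setoid X) (s : Setoid Y) :
    Setoid.comap i (r ⊔ Setoid.map s i) = Setoid.comap i r ⊔ s := by
  classical
  apply le_antisymm
  · -- a relation on `X` extending the right-hand side
    let t : Setoid X :=
      { r := fun x y => r x y ∨ ∃ a b, r x (i a) ∧ (Setoid.comap i r ⊔ s) a b ∧ r (i b) y
        iseqv :=
          { refl := fun x => Or.inl (r.refl' x)
            symm := by
              rintro x y (h | ⟨a, b, h1, h2, h3⟩)
              · exact Or.inl (r.symm' h)
              · exact Or.inr ⟨b, a, r.symm' h3, Setoid.symm' _ h2, r.symm' h1⟩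
            trans := by
              rintro x y z (h | ⟨a, b, h1, h2, h3⟩) (h' | ⟨a', b', h1', h2', h3'⟩)
              · exact Or.inl (r.trans' h h')
              · exact Or.inr ⟨a', b', r.trans' h h1', h2', h3'⟩
              · exact Or.inr ⟨a, b, h1, h2, r.trans' h3 h'⟩
              · refine Or.inr ⟨a, b', h1, ?_, h3'⟩
                have : Setoid.comap i r b a' := r.trans' h3 h1'
                exact Setoid.trans' _ (Setoid.trans' _ h2
                  ((le_sup_left : Setoid.comap i r ≤ _) this)) h2' } }
    have ht : r ⊔ Setoid.map s i ≤ t := by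
      refine sup_le (fun x y h => Or.inl h) ?_
      rw [map_le_iff]
      intro a b h
      exact Or.inr ⟨a, b, r.refl' _, (le_sup_right : s ≤ _) h, r.refl' _⟩
    intro x y h
    rcases ht h with h | ⟨a, b, h1, h2, h3⟩
    · exact (le_sup_left : Setoid.comap i r ≤ _) h
    · exact Setoid.trans' _ (Setoid.trans' _ ((le_sup_left : Setoid.comap i r ≤ _) h1) h2)
        ((le_sup_left : Setoid.comap i r ≤ _) h3)
  · refine sup_le ?_ ?_
    · intro x y h
      exact (le_sup_left : r ≤ r ⊔ Setoid.map s i) h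
    · intro x y h
      exact (le_sup_right : Setoid.map s i ≤ r ⊔ Setoid.map s i) (map_rel s i h)

theorem comap_map_pullback {i : Y → X} {j : Z → X} {i' : W → Z} {j' : W → Y}
    (hj : j.Injective) (hi : i.Injective) (hj' : j'.Injective) (hsq : ∀ w, i (j' w) = j (i' w))
    (hpb : ∀ y z, i y = j z → ∃ w, y = j' w ∧ z = i' w) (q : Setoid Z) :
    Setoid.comap i (Setoid.map q j) = Setoid.map (Setoid.comap i' q) j' := by
  apply Setoid.ext
  intro x y
  rw [map_iff _ hj', Setoid.comap_rel, map_iff _ hj]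
  constructor
  · rintro (⟨a, b, h, ha, hb⟩ | h)
    · obtain ⟨w, rfl, rfl⟩ := hpb x a ha.symm
      obtain ⟨v, rfl, rfl⟩ := hpb y b hb.symm
      exact Or.inl ⟨w, v, h, rfl, rfl⟩
    · exact Or.inr (hi h)
  · rintro (⟨a, b, h, rfl, rfl⟩ | h)
    · exact Or.inl ⟨i' a, i' b, h, (hsq a).symm, (hsq b).symm⟩
    · exact Or.inr (congrArg i h)

theorem classesIn_sup_map [Finite X] {i : Y → X} (hi : i.Injective) (r : Setoid X)
    (s : Setoid Y) (U : Set Y) :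
    classesIn (r ⊔ Setoid.map s i) (i '' U ∪ (Set.range i)ᶜ)
      = classesIn r (Set.range i)ᶜ + classesIn (Setoid.comap i r ⊔ s) U := by
  classical
  set t := r ⊔ Setoid.map s i with ht
  have htc : Setoid.comap i t = Setoid.comap i r ⊔ s := comap_sup_map i r s
  rw [← htc]
  -- relations starting off the range of `i`
  have off : ∀ x y, (∀ z, r x z → z ∉ Set.range i) → t x y → r x y := by
    intro x y hx hxy
    let u : Setoid X :=
      { r := fun a b => r x a ↔ r x b
        iseqv := ⟨fun _ => Iff.rfl, fun h => h.symm, fun h h' => h.trans h'⟩ }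
    have hu : t ≤ u := by
      refine sup_le ?_ ?_
      · intro a b h
        exact ⟨fun h' => r.trans' h' h, fun h' => r.trans' h' (r.symm' h)⟩
      · rw [map_le_iff]
        intro a b _
        exact ⟨fun h' => absurd ⟨a, rfl⟩ (hx _ h'), fun h' => absurd ⟨b, rfl⟩ (hx _ h')⟩
    exact (hu hxy).1 (r.refl' x)
  have hrt : r ≤ t := le_sup_left
  have hsplit : {c ∈ t.classes | c ⊆ i '' U ∪ (Set.range i)ᶜ} =
      {c ∈ r.classes | c ⊆ (Set.range i)ᶜ} ∪
      {c ∈ t.classes | c ⊆ i '' U ∪ (Set.range i)ᶜ ∧ ∃ y, i y ∈ c} := by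
    ext c
    constructor
    · rintro ⟨⟨x, rfl⟩, hc⟩
      by_cases hy : ∃ y, i y ∈ {z | t z x}
      · exact Or.inr ⟨⟨x, rfl⟩, hc, hy⟩
      · left
        have h1 : ∀ z, r x z → z ∉ Set.range i := by
          rintro _ hz ⟨y, rfl⟩
          exact hy ⟨y, t.symm' (hrt hz)⟩
        refine ⟨⟨x, ?_⟩, ?_⟩
        · ext z
          exact ⟨fun h => r.symm' (off x z h1 (t.symm' h)), fun h => hrt h⟩
        · rintro _ hz ⟨y, rfl⟩
          exact hy ⟨y, hz⟩
    · rintro (⟨⟨x, rfl⟩, hc⟩ | ⟨h1, h2, -⟩)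
      · have h1 : ∀ z, r x z → z ∉ Set.range i := fun z hz => hc (r.symm' hz)
        refine ⟨⟨x, ?_⟩, fun z hz => Or.inr (hc hz)⟩
        ext z
        exact ⟨fun h => hrt h, fun h => r.symm' (off x z h1 (t.symm' h))⟩
      · exact ⟨h1, h2⟩
  have hdisj : Disjoint {c ∈ r.classes | c ⊆ (Set.range i)ᶜ}
      {c ∈ t.classes | c ⊆ i '' U ∪ (Set.range i)ᶜ ∧ ∃ y, i y ∈ c} := by
    rw [Set.disjoint_left]
    rintro c ⟨-, hc⟩ ⟨-, -, y, hy⟩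
    exact hc hy ⟨y, rfl⟩
  unfold classesIn
  rw [hsplit, Set.ncard_union_eq hdisj (Set.toFinite _) (Set.toFinite _)]
  congr 1
  refine Set.ncard_congr (fun c _ => i ⁻¹' c) ?_ ?_ ?_
  · rintro c ⟨⟨x, rfl⟩, hc, y, hy⟩
    refine ⟨⟨y, ?_⟩, ?_⟩
    · ext z
      exact ⟨fun h => t.trans' h (t.symm' hy), fun h => t.trans' h hy⟩
    · intro z hz
      rcases hc hz with ⟨z', hz', h⟩ | h
      · exact hi h ▸ hz'
      · exact absurd ⟨z, rfl⟩ h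
  · rintro c d ⟨⟨x, rfl⟩, hc, y, hy⟩ ⟨⟨x', rfl⟩, hc', y', hy'⟩ h
    have h1 : t (i y) x' := by
      have : y ∈ i ⁻¹' {z | t z x'} := h ▸ hy
      exact this
    ext z
    exact ⟨fun h => t.trans' (t.trans' h (t.symm' hy)) h1,
      fun h => t.trans' (t.trans' h (t.symm' h1)) hy⟩
  · rintro c ⟨⟨y, rfl⟩, hc⟩
    refine ⟨{z | t z (i y)}, ⟨⟨i y, rfl⟩, ?_, y, t.refl' _⟩, rfl⟩
    intro z hz
    by_cases hzr : z ∈ Set.range i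
    · obtain ⟨w, rfl⟩ := hzr
      exact Or.inl ⟨w, hc hz, rfl⟩
    · exact Or.inr hzr

theorem classesIn_map {j : Z → X} (hj : j.Injective) (q : Setoid Z) (U : Set X)
    (hU : U ⊆ Set.range j) : classesIn (Setoid.map q j) U = classesIn q (j ⁻¹' U) := by
  unfold classesIn
  symm
  refine Set.ncard_congr (fun c _ => j '' c) ?_ ?_ ?_
  · rintro c ⟨⟨x, rfl⟩, hc⟩
    refine ⟨⟨j x, ?_⟩, Set.image_subset_iff.2 hc⟩
    ext z
    constructor
    · rintro ⟨w, hw, rfl⟩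
      exact map_rel q j hw
    · intro h
      rcases (map_iff q hj).1 h with ⟨a, b, hab, rfl, hb⟩ | h
      · exact ⟨a, (hj hb) ▸ hab, rfl⟩
      · exact ⟨x, q.refl' x, h.symm⟩
  · intro c d _ _ h
    exact hj.image_injective h
  · rintro c ⟨⟨x, rfl⟩, hc⟩
    obtain ⟨y, rfl⟩ := hU (hc (show Setoid.map q j x x from Setoid.refl' _ x))
    refine ⟨{z | q z y}, ⟨⟨y, rfl⟩, ?_⟩, ?_⟩
    · intro z hz
      exact hc (map_rel q j hz)
    · ext z
      constructor
      · rintro ⟨w, hw, rfl⟩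
        exact map_rel q j hw
      · intro h
        rcases (map_iff q hj).1 h with ⟨a, b, hab, rfl, hb⟩ | h
        · exact ⟨a, (hj hb) ▸ hab, rfl⟩
        · exact ⟨y, q.refl' y, h.symm⟩

/-- Gluing along a pullback square of injections: relations. -/
theorem glue_rel {i : Y → X} {j : Z → X} {i' : W → Z} {j' : W → Y}
    (hj : j.Injective) (hi : i.Injective) (hj' : j'.Injective) (hsq : ∀ w, i (j' w) = j (i' w))
    (hpb : ∀ y z, i y = j z → ∃ w, y = j' w ∧ z = i' w) (q : Setoid Z) (s : Setoid Y) :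
    Setoid.comap i (Setoid.map q j ⊔ Setoid.map s i)
      = Setoid.map (Setoid.comap i' q) j' ⊔ s := by
  rw [comap_sup_map i, comap_map_pullback hj hi hj' hsq hpb]

/-- Gluing along a pullback square of injections: numbers of classes. -/
theorem glue_classes [Finite X] {i : Y → X} {j : Z → X} {i' : W → Z} {j' : W → Y}
    (hj : j.Injective) (hi : i.Injective) (hj' : j'.Injective) (hsq : ∀ w, i (j' w) = j (i' w))
    (hpb : ∀ y z, i y = j z → ∃ w, y = j' w ∧ z = i' w) (q : Setoid Z) (s : Setoid Y)
    (U : Set Y) (V : Set X) (T : Set Z) (hV : V = i '' U ∪ (Set.range i)ᶜ)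
    (hT : T = j ⁻¹' (Set.range i)ᶜ) (hcov : (Set.range i)ᶜ ⊆ Set.range j) :
    classesIn (Setoid.map q j ⊔ Setoid.map s i) V
      = classesIn q T + classesIn (Setoid.map (Setoid.comap i' q) j' ⊔ s) U := by
  rw [hV, hT, classesIn_sup_map hi, classesIn_map hj _ _ hcov,
    comap_map_pullback hj hi hj' hsq hpb]

end Glue

section Assoc
variable {A B C D : Type*}

theorem upper_injective : (upper : A ⊕ B → A ⊕ B ⊕ C).Injective := by
  rintro (a | b) (a' | b') h <;> simp_all [upper]

theorem lower_injective : (lower : B ⊕ C → A ⊕ B ⊕ C).Injective := Sum.inr_injective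

theorem outer_injective : (outer : A ⊕ C → A ⊕ B ⊕ C).Injective := by
  rintro (a | b) (a' | b') h <;> simp_all [outer]

/-- Embeddings of three of four rows. -/
def skip4 : A ⊕ B ⊕ C → A ⊕ B ⊕ C ⊕ D :=
  Sum.elim Sum.inl (Sum.elim (fun b => Sum.inr (Sum.inl b)) fun c => Sum.inr (Sum.inr (Sum.inl c)))

def skip3 : A ⊕ B ⊕ D → A ⊕ B ⊕ C ⊕ D :=
  Sum.elim Sum.inl (Sum.elim (fun b => Sum.inr (Sum.inl b)) fun d => Sum.inr (Sum.inr (Sum.inr d)))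

def skip2 : A ⊕ C ⊕ D → A ⊕ B ⊕ C ⊕ D := Sum.elim Sum.inl (fun x => Sum.inr (Sum.inr x))

def skip1 : B ⊕ C ⊕ D → A ⊕ B ⊕ C ⊕ D := Sum.inr

theorem skip4_injective : (skip4 : A ⊕ B ⊕ C → A ⊕ B ⊕ C ⊕ D).Injective := by
  rintro (a | b | c) (a' | b' | c') h <;> simp_all [skip4]
theorem skip3_injective : (skip3 : A ⊕ B ⊕ D → A ⊕ B ⊕ C ⊕ D).Injective := by
  rintro (a | b | c) (a' | b' | c') h <;> simp_all [skip3]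
theorem skip2_injective : (skip2 : A ⊕ C ⊕ D → A ⊕ B ⊕ C ⊕ D).Injective := by
  rintro (a | b | c) (a' | b' | c') h <;> simp_all [skip2]
theorem skip1_injective : (skip1 : B ⊕ C ⊕ D → A ⊕ B ⊕ C ⊕ D).Injective := Sum.inr_injective

theorem sq_left (w : A ⊕ C) :
    (skip2 (upper w) : A ⊕ B ⊕ C ⊕ D) = skip4 (outer w) := by
  rcases w with a | c <;> rfl

theorem pb_left (y : A ⊕ C ⊕ D) (z : A ⊕ B ⊕ C) (h : (skip2 y : A ⊕ B ⊕ C ⊕ D) = skip4 z) :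
    ∃ w : A ⊕ C, y = upper w ∧ z = outer w := by
  rcases y with a | c | d <;> rcases z with a' | b' | c' <;> simp [skip2, skip4] at h
  · exact ⟨Sum.inl a, rfl, by rw [h]; rfl⟩
  · exact ⟨Sum.inr c, rfl, by rw [h]; rfl⟩

theorem sq_right (w : B ⊕ D) :
    (skip3 (lower w) : A ⊕ B ⊕ C ⊕ D) = skip1 (outer w) := by
  rcases w with a | c <;> rfl

theorem pb_right (y : A ⊕ B ⊕ D) (z : B ⊕ C ⊕ D) (h : (skip3 y : A ⊕ B ⊕ C ⊕ D) = skip1 z) :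
    ∃ w : B ⊕ D, y = lower w ∧ z = outer w := by
  rcases y with a | c | d <;> rcases z with a' | b' | c' <;> simp [skip3, skip1] at h
  · exact ⟨Sum.inl c, rfl, by rw [h]; rfl⟩
  · exact ⟨Sum.inr d, rfl, by rw [h]; rfl⟩

variable (α : Setoid (A ⊕ B)) (β : Setoid (B ⊕ C)) (γ : Setoid (C ⊕ D))

theorem stack3 : Setoid.map (stack α β) (skip4 : A ⊕ B ⊕ C → A ⊕ B ⊕ C ⊕ D) ⊔
      Setoid.map (Setoid.map γ lower) skip2
    = Setoid.map (stack β γ) skip1 ⊔ Setoid.map (Setoid.map α upper) skip3 := by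
  have e1 : (skip4 ∘ upper : A ⊕ B → A ⊕ B ⊕ C ⊕ D) = skip3 ∘ upper := by
    funext x; rcases x with x | x <;> rfl
  have e2 : (skip4 ∘ lower : B ⊕ C → A ⊕ B ⊕ C ⊕ D) = skip1 ∘ upper := by
    funext x; rcases x with x | x <;> rfl
  have e3 : (skip2 ∘ lower : C ⊕ D → A ⊕ B ⊕ C ⊕ D) = skip1 ∘ lower := by
    funext x; rcases x with x | x <;> rfl
  unfold stack
  rw [map_sup, map_sup]
  simp only [map_map]
  rw [e1, e2, e3]
  ac_rfl

theorem stack_comp_left : stack (comp α β) γ = Setoid.comap skip2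
    (Setoid.map (stack α β) (skip4 : A ⊕ B ⊕ C → A ⊕ B ⊕ C ⊕ D) ⊔
      Setoid.map (Setoid.map γ lower) skip2) :=
  (glue_rel skip4_injective skip2_injective upper_injective sq_left pb_left _ _).symm

theorem stack_comp_right : stack α (comp β γ) = Setoid.comap skip3
    (Setoid.map (stack β γ) (skip1 : B ⊕ C ⊕ D → A ⊕ B ⊕ C ⊕ D) ⊔
      Setoid.map (Setoid.map α upper) skip3) := by
  rw [glue_rel skip1_injective skip3_injective lower_injective sq_right pb_right, sup_comm]
  rfl

theorem comp_assoc : comp (comp α β) γ = comp α (comp β γ) := by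
  change Setoid.comap outer (stack (comp α β) γ) = Setoid.comap outer (stack α (comp β γ))
  rw [stack_comp_left, stack_comp_right, stack3, ← Setoid.comap_comp, ← Setoid.comap_comp]
  apply Setoid.ext
  rintro (x | x) (y | y) <;> exact Iff.rfl

theorem loops_assoc [Finite A] [Finite B] [Finite C] [Finite D] :
    loops α β + loops (comp α β) γ = loops β γ + loops α (comp β γ) := by
  have hl := glue_classes (skip4_injective (A := A) (B := B) (C := C) (D := D)) skip2_injective
    upper_injective sq_left pb_left (stack α β) (Setoid.map γ lower) (Set.range mid)
    ({x | ∃ b, x = Sum.inr (Sum.inl b)} ∪ {x | ∃ c, x = Sum.inr (Sum.inr (Sum.inl c))})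
    (Set.range mid)
    (by
      ext x
      rcases x with x | x | x | x <;> simp [skip2, mid])
    (by
      ext x
      rcases x with x | x | x  <;> simp [skip2, skip4, mid])
    (by
      intro x
      rcases x with x | x | x | x <;> simp [skip2, skip4])
  have hr := glue_classes (skip1_injective (A := A) (B := B) (C := C) (D := D)) skip3_injective
    lower_injective sq_right pb_right (stack β γ) (Setoid.map α upper) (Set.range mid)
    ({x | ∃ b, x = Sum.inr (Sum.inl b)} ∪ {x | ∃ c, x = Sum.inr (Sum.inr (Sum.inl c))})
    (Set.range mid)
    (by
      ext x
      rcases x with x | x | x | x <;> simp [skip3, mid])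
    (by
      ext x
      rcases x with x | x | x  <;> simp [skip1, skip3, mid])
    (by
      intro x
      rcases x with x | x | x | x <;> simp [skip1, skip3])
  rw [stack3, hr] at hl
  rw [sup_comm (Setoid.map (Setoid.comap outer (stack β γ)) lower)] at hl
  exact hl.symm

/-- The identity diagram, with blocks `{i, i'}`. -/
def idDiag (A : Type*) : Setoid (A ⊕ A) := Setoid.ker (Sum.elim id id)

theorem id_comp (α : Setoid (A ⊕ B)) : comp (idDiag A) α = α := by
  apply le_antisymm
  · let φ : A ⊕ A ⊕ B → A ⊕ B := Sum.elim Sum.inl (Sum.elim Sum.inl Sum.inr)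
    have h : stack (idDiag A) α ≤ Setoid.comap φ α := by
      refine sup_le ?_ ?_ <;> rw [map_le_iff]
      · rintro (x | x) (y | y) h <;> (obtain rfl : x = y := h; exact α.refl' _)
      · rintro (x | x) (y | y) h <;> exact h
    rintro (x | x) (y | y) hxy <;> exact h hxy
  · have h1 : ∀ x : A ⊕ B, stack (idDiag A) α (outer x) (lower x) := by
      rintro (x | x)
      · refine (le_sup_left : Setoid.map (idDiag A) upper ≤ _) ?_
        exact map_rel (idDiag A) upper (show idDiag A (Sum.inl x) (Sum.inr x) from rfl)
      · exact Setoid.refl' _ _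
    intro x y h
    exact Setoid.trans' (stack (idDiag A) α) (Setoid.trans' _ (h1 x)
      ((le_sup_right : Setoid.map α lower ≤ _) (map_rel α lower h))) (Setoid.symm' _ (h1 y))

theorem comp_id (α : Setoid (A ⊕ B)) : comp α (idDiag B) = α := by
  apply le_antisymm
  · let φ : A ⊕ B ⊕ B → A ⊕ B := Sum.elim Sum.inl (Sum.elim Sum.inr Sum.inr)
    have h : stack α (idDiag B) ≤ Setoid.comap φ α := by
      refine sup_le ?_ ?_ <;> rw [map_le_iff]
      · rintro (x | x) (y | y) h <;> exact h
      · rintro (x | x) (y | y) h <;> (obtain rfl : x = y := h; exact α.refl' _)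
    rintro (x | x) (y | y) hxy <;> exact h hxy
  · have h1 : ∀ x : A ⊕ B, stack α (idDiag B) (outer x) (upper x) := by
      rintro (x | x)
      · exact Setoid.refl' _ _
      · refine (le_sup_right : Setoid.map (idDiag B) lower ≤ _) ?_
        exact map_rel (idDiag B) lower (show idDiag B (Sum.inr x) (Sum.inl x) from rfl)
    intro x y h
    exact Setoid.trans' (stack α (idDiag B)) (Setoid.trans' _ (h1 x)
      ((le_sup_left : Setoid.map α upper ≤ _) (map_rel α upper h))) (Setoid.symm' _ (h1 y))

theorem loops_id_left (α : Setoid (A ⊕ B)) : loops (idDiag A) α = 0 := by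
  unfold loops classesIn
  convert Set.ncard_empty (Set (A ⊕ A ⊕ B))
  rw [Set.eq_empty_iff_forall_notMem]
  rintro c ⟨⟨x, rfl⟩, hc⟩
  obtain ⟨y, rfl⟩ := hc (show stack (idDiag A) α x x from Setoid.refl' _ x)
  have h : stack (idDiag A) α (Sum.inl y) (mid y) :=
    (le_sup_left : Setoid.map (idDiag A) upper ≤ _)
      (map_rel (idDiag A) upper (show idDiag A (Sum.inl y) (Sum.inr y) from rfl))
  obtain ⟨z, hz⟩ := hc h
  simp [mid] at hz

theorem loops_id_right (α : Setoid (A ⊕ B)) : loops α (idDiag B) = 0 := by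
  unfold loops classesIn
  convert Set.ncard_empty (Set (A ⊕ B ⊕ B))
  rw [Set.eq_empty_iff_forall_notMem]
  rintro c ⟨⟨x, rfl⟩, hc⟩
  obtain ⟨y, rfl⟩ := hc (show stack α (idDiag B) x x from Setoid.refl' _ x)
  have h : stack α (idDiag B) (Sum.inr (Sum.inr y)) (mid y) :=
    (le_sup_right : Setoid.map (idDiag B) lower ≤ _)
      (map_rel (idDiag B) lower (show idDiag B (Sum.inr y) (Sum.inl y) from rfl))
  obtain ⟨z, hz⟩ := hc h
  simp [mid] at hz

end Assoc
end Diagram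

namespace Diagram

section Pairing
variable {A B C X : Type*}

/-- Every block has exactly two elements. -/
def AllPairs (r : Setoid X) : Prop := ∀ c ∈ r.classes, c.ncard = 2

theorem allPairs_iff {r : Setoid X} :
    AllPairs r ↔ ∀ x, ∃ y, y ≠ x ∧ ∀ z, r x z ↔ z = x ∨ z = y := by
  constructor
  · intro h x
    have h2 := h _ (r.mem_classes x)
    obtain ⟨a, b, hab, hs⟩ := Set.ncard_eq_two.1 h2
    have hz : ∀ z, r x z ↔ z = a ∨ z = b := by
      intro z
      have : z ∈ {w | r w x} ↔ z ∈ ({a, b} : Set X) := by rw [hs]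
      rw [r.comm']
      simpa using this
    rcases (hz x).1 (r.refl' x) with rfl | rfl
    · exact ⟨b, hab.symm, hz⟩
    · exact ⟨a, hab, fun z => (hz z).trans or_comm⟩
  · rintro h _ ⟨x, rfl⟩
    obtain ⟨y, hy, hz⟩ := h x
    rw [Set.ncard_eq_two]
    refine ⟨x, y, hy.symm, ?_⟩
    ext z
    rw [Set.mem_ofPred_eq, r.comm', hz]
    simp

theorem AllPairs.exists_partner {r : Setoid X} (h : AllPairs r) :
    ∃ p : X → X, p.Involutive ∧ (∀ x, p x ≠ x) ∧ ∀ x z, r x z ↔ z = x ∨ z = p x := by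
  choose p hp hr using allPairs_iff.1 h
  refine ⟨p, fun x => ?_, hp, hr⟩
  have h1 : r (p x) x := r.symm' ((hr x (p x)).2 (Or.inr rfl))
  rcases (hr _ _).1 h1 with h2 | h2
  · exact absurd h2.symm (hp x)
  · exact h2.symm

theorem two_endpoints [Finite X] {f g : X → X} (hf : f.Involutive) (hg : g.Involutive)
    {t : Setoid X} (htf : ∀ a, t a (f a)) (htg : ∀ a, t a (g a))
    (ht : ∀ s : Setoid X, (∀ a, s a (f a)) → (∀ a, s a (g a)) → t ≤ s)
    {x : X} (hgx : g x = x) (hfx : f x ≠ x) :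
    ∃ y, y ≠ x ∧ t x y ∧ (f y = y ∨ g y = y) ∧
      ∀ z, t x z → (f z = z ∨ g z = z) → z = x ∨ z = y := by
  set h : X → X := f ∘ g with hh
  have hinj : h.Injective := hf.injective.comp hg.injective
  have hper : x ∈ Function.periodicPts h := by
    have := hinj.mem_periodicPts x
    exact this
  set N := Function.minimalPeriod h x with hN
  have hN0 : 0 < N := Function.minimalPeriod_pos_of_mem_periodicPts hper
  have hNx : h^[N] x = x := Function.iterate_minimalPeriod
  have hN1 : N ≠ 1 := by
    intro h1
    rw [h1] at hNx
    apply hfx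
    simpa [hh, hgx] using hNx
  have key : ∀ i, h^[i] (g (h^[i] x)) = x := by
    intro i
    induction i with
    | zero => exact hgx
    | succ i ih =>
      rw [Function.iterate_succ_apply, Function.iterate_succ_apply' h i x]
      have : h (g (h (h^[i] x))) = g (h^[i] x) := by
        simp only [hh, Function.comp_apply, hg _, hf _]
      rw [this, ih]
  have hdvd : ∀ m, h^[m] x = x → N ∣ m := fun m hm =>
    Function.IsPeriodicPt.minimalPeriod_dvd hm
  have hfg : ∀ z, f z = h (g z) := fun z => by simp only [hh, Function.comp_apply, hg _]
  have htO : ∀ i, t x (h^[i] x) := by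
    intro i
    induction i with
    | zero => exact t.refl' x
    | succ i ih =>
      rw [Function.iterate_succ_apply']
      exact t.trans' ih (t.trans' (htg _) (htf _))
  have hgO : ∀ z, (∃ i, h^[i] x = z) → ∃ i, h^[i] x = g z := by
    rintro _ ⟨i, rfl⟩
    refine ⟨i * (N - 1), hinj.iterate i ?_⟩
    rw [key, ← Function.iterate_add_apply]
    have : i + i * (N - 1) = N * i := by
      obtain ⟨M, hM⟩ : ∃ M, N = M + 1 := ⟨N - 1, by omega⟩
      rw [hM, Nat.add_sub_cancel]; ring
    rw [this]
    exact Function.IsPeriodicPt.mul_const (show Function.IsPeriodicPt h N x from hNx) i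
  have hfO : ∀ z, (∃ i, h^[i] x = z) → ∃ i, h^[i] x = f z := by
    intro z hz
    obtain ⟨i, hi⟩ := hgO z hz
    exact ⟨i + 1, by rw [Function.iterate_succ_apply', hi, ← hfg]⟩
  have hO : ∀ z, t x z → ∃ i, h^[i] x = z := by
    intro z hz
    let s : Setoid X :=
      { r := fun a b => (∃ i, h^[i] x = a) ↔ (∃ i, h^[i] x = b)
        iseqv := ⟨fun _ => Iff.rfl, fun h => h.symm, fun h h' => h.trans h'⟩ }
    have hs : t ≤ s := by
      refine ht s (fun a => ⟨hfO a, fun h' => ?_⟩) (fun a => ⟨hgO a, fun h' => ?_⟩)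
      · have := hfO _ h'; rwa [hf] at this
      · have := hgO _ h'; rwa [hg] at this
    exact (hs hz).1 ⟨0, rfl⟩
  have hgfix : ∀ i, g (h^[i] x) = h^[i] x ↔ h^[2 * i] x = x := by
    intro i
    rw [two_mul, Function.iterate_add_apply]
    constructor
    · intro h1
      have := key i
      rwa [h1] at this
    · intro h1
      exact hinj.iterate i ((key i).trans h1.symm)
  have hffix : ∀ i, 0 < i → (f (h^[i] x) = h^[i] x ↔ h^[2 * i - 1] x = x) := by
    intro i hi
    obtain ⟨j, rfl⟩ : ∃ j, i = j + 1 := ⟨i - 1, by omega⟩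
    have k1 : h^[j] (f (h^[j+1] x)) = x := by
      rw [hfg, ← Function.iterate_succ_apply]
      exact key (j + 1)
    have e : 2 * (j + 1) - 1 = j + (j + 1) := by omega
    rw [e, Function.iterate_add_apply h j (j + 1)]
    constructor
    · intro h1
      rwa [h1] at k1
    · intro h1
      exact hinj.iterate j (k1.trans h1.symm)
  have hc1 : 0 < (N + 1) / 2 := by omega
  have hc2 : (N + 1) / 2 < N := by omega
  refine ⟨h^[(N + 1) / 2] x, ?_, htO _, ?_, ?_⟩
  · intro h1
    exact absurd (Nat.le_of_dvd hc1 (hdvd _ h1)) (by omega)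
  · rcases Nat.even_or_odd' N with ⟨m, hm | hm⟩
    · right
      rw [hgfix]
      have : 2 * ((N + 1) / 2) = N := by omega
      rw [this, hNx]
    · left
      rw [hffix _ hc1]
      have : 2 * ((N + 1) / 2) - 1 = N := by omega
      rw [this, hNx]
  · intro z hz hfix
    obtain ⟨i, rfl⟩ := hO z hz
    rw [← Function.iterate_mod_minimalPeriod_eq, ← hN] at hfix ⊢
    have hi := Nat.mod_lt i hN0
    generalize i % N = k at *
    rcases Nat.eq_zero_or_pos k with rfl | hk
    · exact Or.inl rfl
    · right
      have : k = (N + 1) / 2 := by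
        rcases hfix with h1 | h1
        · rw [hffix _ hk] at h1
          obtain ⟨c, hc⟩ := hdvd _ h1
          have : c = 1 := by
            have h3 : c < 2 := by
              by_contra h4
              have : N * 2 ≤ N * c := Nat.mul_le_mul_left N (by omega)
              omega
            have h5 : c ≠ 0 := by rintro rfl; omega
            omega
          subst this
          omega
        · rw [hgfix] at h1
          obtain ⟨c, hc⟩ := hdvd _ h1
          have : c = 1 := by
            have h3 : c < 2 := by
              by_contra h4
              have : N * 2 ≤ N * c := Nat.mul_le_mul_left N (by omega)
              omega
            have h5 : c ≠ 0 := by rintro rfl; omega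
            omega
          subst this
          omega
      rw [this]

theorem AllPairs.comp [Finite A] [Finite B] [Finite C] {α : Setoid (A ⊕ B)}
    {β : Setoid (B ⊕ C)} (hα : AllPairs α) (hβ : AllPairs β) : AllPairs (comp α β) := by
  obtain ⟨p, hp, hp', hpr⟩ := hα.exists_partner
  obtain ⟨q, hq, hq', hqr⟩ := hβ.exists_partner
  let f : A ⊕ B ⊕ C → A ⊕ B ⊕ C := Sum.elim (fun a => upper (p (Sum.inl a)))
    (Sum.elim (fun b => upper (p (Sum.inr b))) (fun c => Sum.inr (Sum.inr c)))
  let g : A ⊕ B ⊕ C → A ⊕ B ⊕ C := Sum.elim Sum.inl (fun y => lower (q y))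
  have fu : ∀ w : A ⊕ B, f (upper w) = upper (p w) := by rintro (w | w) <;> rfl
  have gl : ∀ w : B ⊕ C, g (lower w) = lower (q w) := fun w => rfl
  have hf : f.Involutive := by
    rintro (a | b | c)
    · exact (fu (p (Sum.inl a))).trans (by rw [hp]; rfl)
    · exact (fu (p (Sum.inr b))).trans (by rw [hp]; rfl)
    · rfl
  have hg : g.Involutive := by
    rintro (a | y)
    · rfl
    · exact (gl (q y)).trans (by rw [hq]; rfl)
  have hup : ∀ w, stack α β (upper w) (upper (p w)) := fun w =>
    (le_sup_left : Setoid.map α upper ≤ _) (map_rel α upper ((hpr _ _).2 (Or.inr rfl)))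
  have hlo : ∀ w, stack α β (lower w) (lower (q w)) := fun w =>
    (le_sup_right : Setoid.map β lower ≤ _) (map_rel β lower ((hqr _ _).2 (Or.inr rfl)))
  have htf : ∀ x, stack α β x (f x) := by
    rintro (a | b | c)
    · exact hup (Sum.inl a)
    · exact hup (Sum.inr b)
    · exact Setoid.refl' _ _
  have htg : ∀ x, stack α β x (g x) := by
    rintro (a | y)
    · exact Setoid.refl' _ _
    · exact hlo y
  have ht : ∀ s : Setoid (A ⊕ B ⊕ C), (∀ a, s a (f a)) → (∀ a, s a (g a)) → stack α β ≤ s := by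
    intro s hsf hsg
    refine sup_le ?_ ?_ <;> rw [map_le_iff] <;> intro x y hxy
    · rcases (hpr _ _).1 hxy with rfl | rfl
      · exact s.refl' _
      · rw [← fu]; exact hsf _
    · rcases (hqr _ _).1 hxy with rfl | rfl
      · exact s.refl' _
      · rw [← gl]; exact hsg _
  have ffix : ∀ x, f x = x → ∃ c, x = Sum.inr (Sum.inr c) := by
    rintro (a | b | c) h
    · exact absurd (upper_injective (a₂ := Sum.inl a) h) (hp' _)
    · exact absurd (upper_injective (a₂ := Sum.inr b) h) (hp' _)
    · exact ⟨c, rfl⟩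
  have gfix : ∀ x, g x = x → ∃ a, x = Sum.inl a := by
    rintro (a | y) h
    · exact ⟨a, rfl⟩
    · exact absurd (Sum.inr_injective h) (hq' _)
  have ofix : ∀ x, (f x = x ∨ g x = x) ↔ ∃ w, x = outer w := by
    intro x
    constructor
    · rintro (h | h)
      · obtain ⟨c, rfl⟩ := ffix x h
        exact ⟨Sum.inr c, rfl⟩
      · obtain ⟨c, rfl⟩ := gfix x h
        exact ⟨Sum.inl c, rfl⟩
    · rintro ⟨w | w, rfl⟩
      · exact Or.inr rfl
      · exact Or.inl rfl
  rw [allPairs_iff]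
  intro w
  have main : ∃ y, y ≠ outer w ∧ stack α β (outer w) y ∧ (f y = y ∨ g y = y) ∧
      ∀ z, stack α β (outer w) z → (f z = z ∨ g z = z) → z = outer w ∨ z = y := by
    rcases w with a | c
    · refine two_endpoints hf hg htf htg ht rfl fun h => ?_
      obtain ⟨c, hc⟩ := ffix _ h
      simp [outer] at hc
    · have := two_endpoints (x := outer (Sum.inr c)) hg hf htg htf
        (fun s h1 h2 => ht s h2 h1) rfl fun h => by
        obtain ⟨c, hc⟩ := gfix _ h
        simp [outer] at hc
      simpa only [or_comm (a := g _ = _)] using this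
  obtain ⟨y, hy, hty, hyf, hyu⟩ := main
  obtain ⟨v, rfl⟩ := (ofix y).1 hyf
  refine ⟨v, fun h => hy (h ▸ rfl), fun z => ⟨fun h => ?_, ?_⟩⟩
  · rcases hyu (outer z) h ((ofix _).2 ⟨z, rfl⟩) with h | h
    · exact Or.inl (outer_injective h)
    · exact Or.inr (outer_injective h)
  · rintro (rfl | rfl)
    · exact Setoid.refl' _ _
    · exact hty

theorem allPairs_id (A : Type*) : AllPairs (idDiag A) := by
  rw [allPairs_iff]
  rintro (a | a)
  · refine ⟨Sum.inr a, by simp, ?_⟩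
    rintro (z | z) <;> change a = z ↔ _ <;> simp [eq_comm]
  · refine ⟨Sum.inl a, by simp, ?_⟩
    rintro (z | z) <;> change a = z ↔ _ <;> simp [eq_comm]

end Pairing

section Planar
variable {n : ℕ}

/-- Position of a vertex on the boundary of the rectangle, read as
`1, …, n, n', …, 1'` (counted from zero). -/
def circ : Fin n ⊕ Fin n → ℕ :=
  Sum.elim (fun i => (i : ℕ)) (fun i => 2 * n - 1 - (i : ℕ))

/-- The diagram can be drawn in the rectangle without crossings: no two distinct blocks
interleave along the boundary of the rectangle. -/
def Planar (r : Setoid (Fin n ⊕ Fin n)) : Prop :=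
  ∀ a b c d, circ a < circ b → circ b < circ c → circ c < circ d → r a c → r b d → r a b

theorem circ_injective : (circ : Fin n ⊕ Fin n → ℕ).Injective := by
  rintro (i | i) (j | j) h <;> simp [circ] at h
  · exact congrArg _ (Fin.ext h)
  · omega
  · omega
  · exact congrArg _ (Fin.ext (by omega))

open Classical in
/-- Parity of the number of points of `P` before `u`. -/
noncomputable def cpar (P : Set (Fin n ⊕ Fin n)) (u : Fin n ⊕ Fin n) : ZMod 2 :=
  ∑ w, if circ w < circ u ∧ w ∈ P then 1 else 0

open Classical in
/-- Parity of the number of points of `Q` to the left of `i`. -/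
noncomputable def rpar (Q : Set (Fin n)) (i : Fin n) : ZMod 2 :=
  ∑ j, if j < i ∧ j ∈ Q then 1 else 0

open Classical in
theorem sum_pairs {X : Type*} [Fintype X] {r : Setoid X} (h : AllPairs r) (S : Set X)
    (hS : ∀ x y, r x y → x ∈ S → y ∈ S) : (∑ w, if w ∈ S then (1 : ZMod 2) else 0) = 0 := by
  obtain ⟨p, hp, hp', hpr⟩ := h.exists_partner
  have hrp : ∀ x, r x (p x) := fun x => (hpr _ _).2 (Or.inr rfl)
  refine Finset.sum_involution (fun x _ => p x) ?_ ?_ ?_ ?_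
  · intro a _
    have : p a ∈ S ↔ a ∈ S := ⟨hS _ _ (r.symm' (hrp a)), hS _ _ (hrp a)⟩
    simp only [this]
    split_ifs
    · decide
    · decide
  · intro a _ _
    exact hp' a
  · intro a _; exact Finset.mem_univ _
  · intro a _; exact hp a

open Classical in
theorem cpar_eq_rpar (P : Set (Fin n ⊕ Fin n))
    (htot : (∑ w, if w ∈ P then (1 : ZMod 2) else 0) = 0) (v : Fin n ⊕ Fin n) (hv : v ∉ P) :
    cpar P v = Sum.elim (rpar (Sum.inl ⁻¹' P)) (rpar (Sum.inr ⁻¹' P)) v := by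
  rw [Fintype.sum_sum_type] at htot
  unfold cpar
  rw [Fintype.sum_sum_type]
  rcases v with i | i
  · have : (∑ j : Fin n, if circ (Sum.inr j : Fin n ⊕ Fin n) < circ (Sum.inl i : Fin n ⊕ Fin n) ∧
        (Sum.inr j : Fin n ⊕ Fin n) ∈ P then (1 : ZMod 2) else 0) = 0 := by
      refine Finset.sum_eq_zero fun j _ => if_neg ?_
      rintro ⟨h, -⟩
      simp only [circ, Sum.elim_inl, Sum.elim_inr] at h
      omega
    rw [this, add_zero]
    rfl
  · have h1 : (∑ j : Fin n, if circ (Sum.inl j : Fin n ⊕ Fin n) < circ (Sum.inr i : Fin n ⊕ Fin n) ∧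
        (Sum.inl j : Fin n ⊕ Fin n) ∈ P then (1 : ZMod 2) else 0)
        = ∑ j : Fin n, if (Sum.inl j : Fin n ⊕ Fin n) ∈ P then (1 : ZMod 2) else 0 := by
      refine Finset.sum_congr rfl fun j _ => ?_
      have : circ (Sum.inl j : Fin n ⊕ Fin n) < circ (Sum.inr i : Fin n ⊕ Fin n) := by
        simp only [circ, Sum.elim_inl, Sum.elim_inr]
        omega
      simp [this]
    have h2 : (∑ j : Fin n, if (Sum.inr j : Fin n ⊕ Fin n) ∈ P then (1 : ZMod 2) else 0)
        = rpar (Sum.inr ⁻¹' P) i +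
        ∑ j : Fin n, if circ (Sum.inr j : Fin n ⊕ Fin n) < circ (Sum.inr i : Fin n ⊕ Fin n) ∧
        (Sum.inr j : Fin n ⊕ Fin n) ∈ P then (1 : ZMod 2) else 0 := by
      unfold rpar
      rw [← Finset.sum_add_distrib]
      refine Finset.sum_congr rfl fun j _ => ?_
      have hc : circ (Sum.inr j : Fin n ⊕ Fin n) < circ (Sum.inr i : Fin n ⊕ Fin n) ↔ i < j := by
        simp only [circ, Sum.elim_inr, Fin.lt_def]
        omega
      simp only [hc, Set.mem_preimage]
      rcases lt_trichotomy i j with h | h | h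
      · simp [h, h.not_gt]
      · subst h
        simp [hv]
      · simp [h, h.not_gt]
    rw [h1]
    rw [h2] at htot
    simp only [Sum.elim_inr]
    have h3 : ∀ a b c : ZMod 2, a + (b + c) = 0 → a + c = b := by decide
    exact h3 _ _ _ htot

open Classical in
theorem cpar_eq_of_rel {r : Setoid (Fin n ⊕ Fin n)} (hr : AllPairs r) (hpl : Planar r)
    {P : Set (Fin n ⊕ Fin n)} (hP : ∀ x y, r x y → x ∈ P → y ∈ P) {u v : Fin n ⊕ Fin n}
    (huv : r u v) (hu : u ∉ P) : cpar P u = cpar P v := by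
  wlog hlt : circ u < circ v generalizing u v
  · rcases Nat.lt_or_ge (circ v) (circ u) with h | h
    · exact (this (r.symm' huv) (fun h' => hu (hP _ _ (r.symm' huv) h')) h).symm
    · rw [circ_injective (le_antisymm (not_lt.1 hlt) h)]
  obtain ⟨y, hy, hyr⟩ := allPairs_iff.1 hr u
  have hvy : v = y := by
    rcases (hyr v).1 huv with h | h
    · subst h; exact absurd hlt (lt_irrefl _)
    · exact h
  subst hvy
  have key := sum_pairs hr {w | (circ u < circ w ∧ circ w < circ v) ∧ w ∈ P} (by
    rintro w w' hww ⟨⟨h1, h2⟩, h3⟩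
    have hw : ¬ r u w := by
      intro h
      rcases (hyr w).1 h with rfl | rfl <;> omega
    have hw' : ¬ r u w' := fun h => hw (r.trans' h (r.symm' hww))
    refine ⟨⟨?_, ?_⟩, hP _ _ hww h3⟩
    · by_contra h
      have hne : circ w' ≠ circ u := fun h' => hw' (circ_injective h' ▸ r.refl' _)
      exact hw' (r.symm' (hpl w' u w v (by omega) h1 h2 (r.symm' hww) huv))
    · by_contra h
      have hne : circ w' ≠ circ v := fun h' => hw' (circ_injective h' ▸ huv)
      exact hw (hpl u w v w' h1 h2 (by omega) huv hww))
  have hsum : cpar P v = cpar P u +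
      ∑ w, if w ∈ {w | (circ u < circ w ∧ circ w < circ v) ∧ w ∈ P} then (1 : ZMod 2) else 0 := by
    unfold cpar
    rw [← Finset.sum_add_distrib]
    refine Finset.sum_congr rfl fun w _ => ?_
    simp only [Set.mem_ofPred_eq]
    by_cases hw : w ∈ P
    · have hne : circ w ≠ circ u := fun h => hu (circ_injective h ▸ hw)
      simp only [hw, and_true]
      rcases Nat.lt_or_gt_of_ne hne with h | h
      · simp [h, h.trans hlt, h.not_gt]
      · simp [h, h.not_gt]
    · simp [hw]
  rw [hsum]
  exact left_eq_add.2 (by convert key)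

theorem Planar.comp {α β : Setoid (Fin n ⊕ Fin n)} (hα : AllPairs α) (hβ : AllPairs β)
    (pα : Planar α) (pβ : Planar β) : Planar (comp α β) := by
  classical
  intro a b c d hab hbc hcd hac hbd
  by_contra hnab
  let K : Set (Fin n ⊕ Fin n ⊕ Fin n) := {x | stack α β (outer a) x}
  have hK : ∀ x y, stack α β x y → x ∈ K → y ∈ K := fun x y h hx => Setoid.trans' _ hx h
  let col : Fin n ⊕ Fin n ⊕ Fin n → ZMod 2 := Sum.elim (rpar (Sum.inl ⁻¹' K))
    (Sum.elim (rpar (mid ⁻¹' K)) (rpar ((fun i => Sum.inr (Sum.inr i)) ⁻¹' K)))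
  let s : Setoid (Fin n ⊕ Fin n ⊕ Fin n) :=
    { r := fun x y => (x ∈ K ↔ y ∈ K) ∧ (x ∉ K → col x = col y)
      iseqv :=
        { refl := fun x => ⟨Iff.rfl, fun _ => rfl⟩
          symm := fun h => ⟨h.1.symm, fun hy => (h.2 (fun hx => hy (h.1.1 hx))).symm⟩
          trans := fun h h' => ⟨h.1.trans h'.1, fun hx =>
            (h.2 hx).trans (h'.2 (fun hy => hx (h.1.2 hy)))⟩ } }
  have hs : stack α β ≤ s := by
    refine sup_le ?_ ?_ <;> rw [map_le_iff] <;> intro x y hxy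
    · have hst : ∀ x y, α x y → stack α β (upper x) (upper y) := fun x y h =>
        (le_sup_left : Setoid.map α upper ≤ _) (map_rel α upper h)
      have hP : ∀ x y, α x y → x ∈ upper ⁻¹' K → y ∈ upper ⁻¹' K :=
        fun x y h => hK _ _ (hst x y h)
      refine ⟨⟨hP _ _ hxy, hP _ _ (α.symm' hxy)⟩, fun hx => ?_⟩
      have htot := sum_pairs hα _ hP
      have hy : y ∉ upper ⁻¹' K := fun h => hx (hP _ _ (α.symm' hxy) h)
      have e := cpar_eq_of_rel hα pα hP hxy hx
      rw [cpar_eq_rpar _ htot x hx, cpar_eq_rpar _ htot y hy] at e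
      have hcol : ∀ x, col (upper x) = Sum.elim (rpar (Sum.inl ⁻¹' (upper ⁻¹' K)))
          (rpar (Sum.inr ⁻¹' (upper ⁻¹' K))) x := by
        rintro (x | x) <;> rfl
      rw [hcol, hcol, e]
    · have hst : ∀ x y, β x y → stack α β (lower x) (lower y) := fun x y h =>
        (le_sup_right : Setoid.map β lower ≤ _) (map_rel β lower h)
      have hP : ∀ x y, β x y → x ∈ lower ⁻¹' K → y ∈ lower ⁻¹' K :=
        fun x y h => hK _ _ (hst x y h)
      refine ⟨⟨hP _ _ hxy, hP _ _ (β.symm' hxy)⟩, fun hx => ?_⟩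
      have htot := sum_pairs hβ _ hP
      have hy : y ∉ lower ⁻¹' K := fun h => hx (hP _ _ (β.symm' hxy) h)
      have e := cpar_eq_of_rel hβ pβ hP hxy hx
      rw [cpar_eq_rpar _ htot x hx, cpar_eq_rpar _ htot y hy] at e
      have hcol : ∀ x, col (lower x) = Sum.elim (rpar (Sum.inl ⁻¹' (lower ⁻¹' K)))
          (rpar (Sum.inr ⁻¹' (lower ⁻¹' K))) x := by
        rintro (x | x) <;> rfl
      rw [hcol, hcol, e]
  have hpair := hα.comp hβ
  have hP : ∀ x y, Diagram.comp α β x y → x ∈ outer ⁻¹' K → y ∈ outer ⁻¹' K :=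
    fun x y h => hK _ _ h
  have htot := sum_pairs hpair _ hP
  have hb : b ∉ outer ⁻¹' K := hnab
  have hd : d ∉ outer ⁻¹' K := fun h => hb (hP _ _ (Setoid.symm' _ hbd) h)
  have hcol : ∀ x, col (outer x) = Sum.elim (rpar (Sum.inl ⁻¹' (outer ⁻¹' K)))
      (rpar (Sum.inr ⁻¹' (outer ⁻¹' K))) x := by
    rintro (x | x) <;> rfl
  have e : cpar (outer ⁻¹' K) b = cpar (outer ⁻¹' K) d := by
    rw [cpar_eq_rpar _ htot b hb, cpar_eq_rpar _ htot d hd, ← hcol, ← hcol]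
    exact (hs hbd).2 hb
  have hmem : ∀ w, w ∈ outer ⁻¹' K ↔ w = a ∨ w = c := by
    obtain ⟨y, hy, hyr⟩ := allPairs_iff.1 hpair a
    have : c = y := by
      rcases (hyr c).1 hac with h | h
      · subst h; omega
      · exact h
    subst this
    exact hyr
  have hcard : ∀ u, cpar (outer ⁻¹' K) u = (if circ a < circ u then 1 else 0) +
      (if circ c < circ u then 1 else 0) := by
    intro u
    unfold cpar
    have hne : a ≠ c := by rintro rfl; omega
    rw [← Finset.sum_subset (Finset.subset_univ {a, c}), Finset.sum_pair hne]
    · simp [hmem]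
    · intro w _ hw
      rw [if_neg]
      rintro ⟨-, h⟩
      rw [hmem] at h
      simp at hw
      tauto
  rw [hcard, hcard, if_pos hab, if_neg (by omega), if_pos (by omega), if_pos hcd] at e
  exact absurd e (by decide)

theorem planar_id : Planar (idDiag (Fin n)) := by
  intro a b c d h1 h2 h3 h4 h5
  change Sum.elim id id a = Sum.elim id id c at h4
  change Sum.elim id id b = Sum.elim id id d at h5
  change Sum.elim id id a = Sum.elim id id b
  rcases a with a | a <;> rcases b with b | b <;> rcases c with c | c <;>
    rcases d with d | d <;> simp [circ] at * <;> omega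

end Planar
end Diagram

/-- The partition monoid: set partitions of the two rows of `n` vertices (`Sum.inl` the upper
row, `Sum.inr` the lower row). -/
@[ext]
structure PartitionMonoid (n : ℕ) where
  rel : Setoid (Fin n ⊕ Fin n)

namespace PartitionMonoid
variable {n : ℕ}

instance : Monoid (PartitionMonoid n) where
  mul α β := ⟨Diagram.comp α.rel β.rel⟩
  one := ⟨Diagram.idDiag (Fin n)⟩
  mul_assoc α β γ := PartitionMonoid.ext (Diagram.comp_assoc α.rel β.rel γ.rel)
  one_mul α := PartitionMonoid.ext (Diagram.id_comp α.rel)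
  mul_one α := PartitionMonoid.ext (Diagram.comp_id α.rel)

/-- The number of transversal blocks. -/
noncomputable def rank (α : PartitionMonoid n) : ℕ :=
  {c ∈ α.rel.classes | (∃ i, Sum.inl i ∈ c) ∧ ∃ j, Sum.inr j ∈ c}.ncard

end PartitionMonoid

/-- The Jones monoid: planar partitions all of whose blocks have size two. -/
def JonesMonoid (n : ℕ) : Submonoid (PartitionMonoid n) where
  carrier := {α | Diagram.AllPairs α.rel ∧ Diagram.Planar α.rel}
  mul_mem' ha hb := ⟨ha.1.comp hb.1, Diagram.Planar.comp ha.1 hb.1 ha.2 hb.2⟩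
  one_mem' := ⟨Diagram.allPairs_id (Fin n), Diagram.planar_id⟩

/-- The set `I_r` of elements of the Jones monoid of rank at most `r`. -/
def jonesIdeal (n r : ℕ) : Set (JonesMonoid n) := {α | α.1.rank ≤ r}

/-- The rank of a subsemigroup `T` (given as a set): the least size of a subset that generates
`T` as a semigroup. -/
noncomputable def semigroupRank {S : Type*} [Semigroup S] (T : Set S) : ℕ :=
  sInf {m | ∃ A : Finset S, A.card = m ∧ (Subsemigroup.closure (A : Set S) : Set S) = T}

/-- A twisting of a monoid `S` with values in `R`. -/
structure Twisting (S R : Type*) [Monoid S] [CommRing R] where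
  toFun : S → S → R
  cocycle : ∀ a b c, toFun a b * toFun (a * b) c = toFun a (b * c) * toFun b c
  one_left : ∀ a, toFun 1 a = 1
  one_right : ∀ a, toFun a 1 = 1

/-- The twisted semigroup algebra: the free module on `S` with `a ⋆ b = ψ(a, b) ab`. -/
def TwistedAlgebra {S R : Type*} [Monoid S] [CommRing R] (_ψ : Twisting S R) : Type _ := S →₀ R

namespace TwistedAlgebra
variable {S R : Type*} [Monoid S] [CommRing R] (ψ : Twisting S R)

noncomputable instance : AddCommGroup (TwistedAlgebra ψ) :=
  inferInstanceAs (AddCommGroup (S →₀ R))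

noncomputable instance : Module R (TwistedAlgebra ψ) :=
  inferInstanceAs (Module R (S →₀ R))

/-- The basis element belonging to `a : S`. -/
noncomputable def of (a : S) : TwistedAlgebra ψ := Finsupp.single a (1 : R)

/-- The elements `of ψ a` form a basis. -/
noncomputable def basis : Module.Basis S R (TwistedAlgebra ψ) :=
  Module.Basis.ofRepr (LinearEquiv.refl R (S →₀ R))

theorem basis_apply (a : S) : basis ψ a = of ψ a := rfl

/-- The bilinear multiplication with `of ψ a * of ψ b = ψ(a, b) of ψ (a * b)`. -/
noncomputable def mulHom :
    TwistedAlgebra ψ →ₗ[R] TwistedAlgebra ψ →ₗ[R] TwistedAlgebra ψ :=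
  (basis ψ).constr R fun a => (basis ψ).constr R fun b => ψ.toFun a b • of ψ (a * b)

theorem mulHom_of (a b : S) : mulHom ψ (of ψ a) (of ψ b) = ψ.toFun a b • of ψ (a * b) := by
  simp only [mulHom, ← basis_apply, Module.Basis.constr_basis]

theorem mulHom_assoc (x y z : TwistedAlgebra ψ) :
    mulHom ψ (mulHom ψ x y) z = mulHom ψ x (mulHom ψ y z) := by
  have h1 : ∀ a b z, mulHom ψ (mulHom ψ (of ψ a) (of ψ b)) z
      = mulHom ψ (of ψ a) (mulHom ψ (of ψ b) z) := by
    intro a b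
    refine LinearMap.congr_fun (f := mulHom ψ (mulHom ψ (of ψ a) (of ψ b)))
      (g := mulHom ψ (of ψ a) ∘ₗ mulHom ψ (of ψ b)) ((basis ψ).ext fun c => ?_)
    simp only [basis_apply, LinearMap.comp_apply, mulHom_of, map_smul, LinearMap.smul_apply,
      smul_smul, mul_assoc, ψ.cocycle]
    rw [mul_comm, mul_comm (ψ.toFun b c), ← ψ.cocycle, mul_comm]
  have h2 : ∀ a y, mulHom ψ (mulHom ψ (of ψ a) y) z = mulHom ψ (of ψ a) (mulHom ψ y z) := by
    intro a
    refine LinearMap.congr_fun (f := (mulHom ψ).flip z ∘ₗ mulHom ψ (of ψ a))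
      (g := mulHom ψ (of ψ a) ∘ₗ (mulHom ψ).flip z) ((basis ψ).ext fun b => ?_)
    exact h1 a b z
  refine LinearMap.congr_fun (f := (mulHom ψ).flip z ∘ₗ (mulHom ψ).flip y)
    (g := (mulHom ψ).flip (mulHom ψ y z)) ((basis ψ).ext fun a => ?_) x
  exact h2 a y

theorem one_mulHom (x : TwistedAlgebra ψ) : mulHom ψ (of ψ 1) x = x := by
  refine LinearMap.congr_fun (f := mulHom ψ (of ψ 1)) (g := LinearMap.id)
    ((basis ψ).ext fun a => ?_) x
  rw [basis_apply, mulHom_of, ψ.one_left, one_mul, one_smul, LinearMap.id_apply]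

theorem mulHom_one (x : TwistedAlgebra ψ) : mulHom ψ x (of ψ 1) = x := by
  refine LinearMap.congr_fun (f := (mulHom ψ).flip (of ψ 1)) (g := LinearMap.id)
    ((basis ψ).ext fun a => ?_) x
  rw [basis_apply, LinearMap.flip_apply, mulHom_of, ψ.one_right, mul_one, one_smul,
    LinearMap.id_apply]

noncomputable instance : Ring (TwistedAlgebra ψ) :=
  { (inferInstance : AddCommGroup (TwistedAlgebra ψ)) with
    mul := fun x y => mulHom ψ x y
    one := of ψ 1
    left_distrib := fun x y z => map_add (mulHom ψ x) y z
    right_distrib := fun x y z => LinearMap.map_add₂ (mulHom ψ) x y z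
    zero_mul := fun x => LinearMap.map_zero₂ (mulHom ψ) x
    mul_zero := fun x => map_zero (mulHom ψ x)
    mul_assoc := mulHom_assoc ψ
    one_mul := one_mulHom ψ
    mul_one := mulHom_one ψ }

theorem of_mul_of (a b : S) : of ψ a * of ψ b = ψ.toFun a b • of ψ (a * b) := mulHom_of ψ a b

theorem one_def : (1 : TwistedAlgebra ψ) = of ψ 1 := rfl

noncomputable instance : Algebra R (TwistedAlgebra ψ) :=
  Algebra.ofModule (fun r x y => LinearMap.map_smul₂ (mulHom ψ) r x y)
    (fun r x y => map_smul (mulHom ψ x) r y)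

end TwistedAlgebra

/-- The twisting `ψ(α, β) = δ ^ m(α, β)`, where `m(α, β)` is the number of components removed
from the middle row when `αβ` is formed. -/
noncomputable def jonesTwisting (n : ℕ) (δ : ℂ) : Twisting (JonesMonoid n) ℂ where
  toFun α β := δ ^ Diagram.loops α.1.rel β.1.rel
  cocycle α β γ := by
    rw [← pow_add, ← pow_add]
    exact congrArg _ ((Diagram.loops_assoc α.1.rel β.1.rel γ.1.rel).trans (add_comm _ _))
  one_left α := by
    change δ ^ Diagram.loops (Diagram.idDiag (Fin n)) α.1.rel = 1
    rw [Diagram.loops_id_left, pow_zero]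
  one_right α := by
    change δ ^ Diagram.loops α.1.rel (Diagram.idDiag (Fin n)) = 1
    rw [Diagram.loops_id_right, pow_zero]

/-- The complex Temperley–Lieb algebra. -/
abbrev TemperleyLieb (n : ℕ) (δ : ℂ) : Type := TwistedAlgebra (jonesTwisting n δ)

/-- The basis element of the Temperley–Lieb algebra belonging to a planar diagram. -/
noncomputable def tlBasis {n : ℕ} (δ : ℂ) (α : JonesMonoid n) : TemperleyLieb n δ :=
  TwistedAlgebra.of (jonesTwisting n δ) α

/-
The upper half of a Jones diagram of rank `r` is a lattice path from `0` to `r` that stays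
nonnegative (a ballot path), and a diagram is determined by its two halves, which can be
prescribed independently. For `r ≤ n - 2` the projections of rank `r` generate the ideal `I_r`:
they produce all diagrams of rank `r`, and a hook times a product of projections is again such a
product. A generating set must contain a diagram with every given upper half of rank `r`, so its
least size is the number of ballot paths, which satisfies the recurrence of Pascal's triangle.

The cell module of a diagram `β` is spanned by the diagrams with the lower half of `β`, with
products of smaller rank set to zero. A diagram of the same rank acts on it by a rank-one operator
whose coefficients depend only on the two half-diagrams that are glued. In a semisimple algebra
every `x` has the form `x y x`, which makes these operators nonzero wherever needed: cell modules
are simple, every simple module contains the image of a cell module (look at the diagrams of least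
rank not annihilating it), and the least such rank tells cell modules apart.
-/

namespace Diagram

section Chains
variable {A B C X : Type*}

theorem AllPairs.eq_of_rel {r : Setoid X} (hr : AllPairs r) {x y z : X} (hxy : r x y)
    (hxz : r x z) (hy : y ≠ x) (hz : z ≠ x) : y = z := by
  obtain ⟨w, -, hw⟩ := allPairs_iff.1 hr x
  rw [((hw y).1 hxy).resolve_left hy, ((hw z).1 hxz).resolve_left hz]

theorem AllPairs.exists_rel {r : Setoid X} (hr : AllPairs r) (x : X) : ∃ y, y ≠ x ∧ r x y := by
  obtain ⟨y, hy, hr⟩ := allPairs_iff.1 hr x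
  exact ⟨y, hy, (hr y).2 (Or.inr rfl)⟩

theorem AllPairs.eq_of_le {r s : Setoid X} (hr : AllPairs r) (hs : AllPairs s) (h : r ≤ s) :
    r = s := by
  refine le_antisymm h fun x z hxz => ?_
  obtain ⟨y, hyx, hxy⟩ := hr.exists_rel x
  rcases eq_or_ne z x with rfl | hzx
  · exact r.refl' z
  · rwa [hs.eq_of_rel hxz (h hxy) hzx hyx]

theorem AllPairs.mem_pair_iff {r : Setoid X} (hr : AllPairs r) {a b x y : X} (hab : r a b)
    (hne : a ≠ b) (hxy : r x y) : x = a ∨ x = b ↔ y = a ∨ y = b := by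
  have hpair : ∀ z, z = a ∨ z = b ↔ r a z := fun z => by
    refine ⟨?_, fun haz => or_iff_not_imp_left.2 fun hz => hr.eq_of_rel haz hab hz hne.symm⟩
    rintro (rfl | rfl)
    · exact r.refl' z
    · exact hab
  rw [hpair, hpair]
  exact ⟨fun h => r.trans' h hxy, fun h => r.trans' h (r.symm' hxy)⟩

variable {α : Setoid (A ⊕ B)} {β : Setoid (B ⊕ C)}

theorem AllPairs.exists_rel_inr_iff (hα : AllPairs α) (i : A) :
    (∃ j, α (Sum.inl i) (Sum.inr j)) ↔ ∀ i', Setoid.comap Sum.inl α i i' → i' = i := by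
  constructor
  · rintro ⟨j, hj⟩ i' hi'
    by_contra hne
    exact Sum.inr_ne_inl (hα.eq_of_rel hj hi' Sum.inr_ne_inl (Sum.inl_injective.ne hne))
  · intro h
    obtain ⟨i' | j, hne, hr⟩ := hα.exists_rel (Sum.inl i)
    · exact absurd (congrArg Sum.inl (h i' hr)) hne
    · exact ⟨j, hr⟩

theorem stack_upper {x y : A ⊕ B} (h : α x y) : stack α β (upper x) (upper y) :=
  (le_sup_left : Setoid.map α upper ≤ _) (map_rel α upper h)

theorem stack_lower {x y : B ⊕ C} (h : β x y) : stack α β (lower x) (lower y) :=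
  (le_sup_right : Setoid.map β lower ≤ _) (map_rel β lower h)

theorem stack_le {s : Setoid (A ⊕ B ⊕ C)} (hα : ∀ x y, α x y → s (upper x) (upper y))
    (hβ : ∀ x y, β x y → s (lower x) (lower y)) : stack α β ≤ s :=
  sup_le (map_le_iff.2 hα) (map_le_iff.2 hβ)

theorem comp_inl_inl {i j : A} (h : α (Sum.inl i) (Sum.inl j)) :
    comp α β (Sum.inl i) (Sum.inl j) :=
  stack_upper h

theorem comp_inr_inr {i j : C} (h : β (Sum.inr i) (Sum.inr j)) :
    comp α β (Sum.inr i) (Sum.inr j) :=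
  stack_lower h

theorem comp_inl_inr {i : A} {j : B} {k : C} (h : α (Sum.inl i) (Sum.inr j))
    (h' : β (Sum.inl j) (Sum.inr k)) : comp α β (Sum.inl i) (Sum.inr k) :=
  (stack α β).trans' (stack_upper h) (stack_lower h')

end Chains

section Flip
variable {A B C : Type*}

/-- Reflection of a diagram in a horizontal line. -/
def flip (α : Setoid (A ⊕ B)) : Setoid (B ⊕ A) := Setoid.comap Sum.swap α

theorem flip_flip (α : Setoid (A ⊕ B)) : flip (flip α) = α :=
  Setoid.ext fun x y => by
    change α x.swap.swap y.swap.swap ↔ _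
    rw [Sum.swap_swap, Sum.swap_swap]

theorem flip_swap {α : Setoid (A ⊕ B)} {x y : A ⊕ B} (h : α x y) : flip α x.swap y.swap := by
  rwa [← flip_flip α] at h

theorem AllPairs.flip {α : Setoid (A ⊕ B)} (h : AllPairs α) : AllPairs (flip α) := by
  rw [allPairs_iff] at h ⊢
  intro x
  obtain ⟨y, hy, hyr⟩ := h x.swap
  have hswap : ∀ z : B ⊕ A, z.swap = y ↔ z = y.swap := fun z =>
    ⟨fun e => by rw [← e, Sum.swap_swap], fun e => by rw [e, Sum.swap_swap]⟩
  refine ⟨y.swap, fun e => hy ((hswap x).2 e.symm).symm, fun z => ?_⟩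
  change α x.swap z.swap ↔ _
  rw [hyr, Sum.swap_leftInverse.injective.eq_iff, hswap]

/-- The mirror map of the stacked graph exchanges the two outer rows. -/
def mirror : A ⊕ B ⊕ C → C ⊕ B ⊕ A :=
  Sum.elim (Sum.inr ∘ Sum.inr) (Sum.elim (Sum.inr ∘ Sum.inl) Sum.inl)

theorem stack_le_comap_mirror (α : Setoid (A ⊕ B)) (β : Setoid (B ⊕ C)) :
    stack α β ≤ Setoid.comap mirror (stack (flip β) (flip α)) :=
  stack_le
    (fun x y h => by
      have := stack_lower (α := flip β) (flip_swap h)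
      rcases x with x | x <;> rcases y with y | y <;> exact this)
    (fun x y h => by
      have := stack_upper (β := flip α) (flip_swap h)
      rcases x with x | x <;> rcases y with y | y <;> exact this)

theorem flip_comp (α : Setoid (A ⊕ B)) (β : Setoid (B ⊕ C)) :
    flip (comp α β) = comp (flip β) (flip α) := by
  have hle := stack_le_comap_mirror α β
  have hge := stack_le_comap_mirror (flip β) (flip α)
  rw [flip_flip, flip_flip] at hge
  apply Setoid.ext
  rintro (x | x) (y | y) <;> exact ⟨fun h => hle h, fun h => hge h⟩

theorem circ_lt {n : ℕ} (x : Fin n ⊕ Fin n) : circ x < 2 * n := by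
  rcases x with i | i <;> simp only [circ, Sum.elim_inl, Sum.elim_inr] <;> omega

theorem circ_swap {n : ℕ} (x : Fin n ⊕ Fin n) : circ x.swap = 2 * n - 1 - circ x := by
  rcases x with i | i <;>
    simp only [circ, Sum.swap_inl, Sum.swap_inr, Sum.elim_inl, Sum.elim_inr]
  omega

theorem Planar.flip {n : ℕ} {α : Setoid (Fin n ⊕ Fin n)} (h : Planar α) : Planar (flip α) := by
  intro a b c d hab hbc hcd hac hbd
  have hswap : ∀ {x y : Fin n ⊕ Fin n}, circ x < circ y → circ y.swap < circ x.swap := by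
    intro x y hxy
    have := circ_lt y
    rw [circ_swap, circ_swap]
    omega
  have hdc : α d.swap c.swap :=
    h _ _ _ _ (hswap hcd) (hswap hbc) (hswap hab) (α.symm' hbd) (α.symm' hac)
  exact α.trans' hac (α.trans' (α.symm' hdc) (α.symm' hbd))

end Flip

section Loops
variable {A B C : Type*} {α α' : Setoid (A ⊕ B)} {β β' : Setoid (B ⊕ C)}

/-- The relation on the middle row of a stacked graph generated by the edges inside that row. -/
def middleRel (α : Setoid (A ⊕ B)) (β : Setoid (B ⊕ C)) : Setoid B :=
  Setoid.comap Sum.inr α ⊔ Setoid.comap Sum.inl β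

/-- The vertices of the middle row that no edge joins to an outer row. -/
def interior (α : Setoid (A ⊕ B)) (β : Setoid (B ⊕ C)) : Set B :=
  {b | (¬ ∃ a, α (Sum.inr b) (Sum.inl a)) ∧ ¬ ∃ c, β (Sum.inl b) (Sum.inr c)}

theorem stack_mid_of_middleRel {b b' : B} (h : middleRel α β b b') :
    stack α β (mid b) (mid b') :=
  (sup_le (c := Setoid.comap mid (stack α β)) (fun _ _ h => stack_upper h)
    (fun _ _ h => stack_lower h)) h

theorem image_middleRel_class {b : B} (hb : {b' | middleRel α β b' b} ⊆ interior α β) :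
    mid '' {b' | middleRel α β b' b} = {x | stack α β x (mid b)} := by
  set s := middleRel α β
  let K : Set (A ⊕ B ⊕ C) := mid '' {b' | s b' b}
  have hupper : ∀ x y, α x y → upper x ∈ K → upper y ∈ K := by
    rintro (a | b₁) (a' | b₂) hxy ⟨b', hb', e⟩ <;> cases e
    · exact absurd ⟨_, hxy⟩ (hb hb').1
    · exact ⟨b₂, s.trans' (s.symm' ((le_sup_left : _ ≤ s) hxy)) hb', rfl⟩
  have hlower : ∀ x y, β x y → lower x ∈ K → lower y ∈ K := by
    rintro (b₁ | c) (b₂ | c') hxy ⟨b', hb', e⟩ <;> cases e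
    · exact ⟨b₂, s.trans' (s.symm' ((le_sup_right : _ ≤ s) hxy)) hb', rfl⟩
    · exact absurd ⟨_, hxy⟩ (hb hb').2
  have hstack : stack α β ≤ Setoid.ker (· ∈ K) := stack_le
    (fun x y h => propext ⟨hupper x y h, hupper y x (α.symm' h)⟩)
    (fun x y h => propext ⟨hlower x y h, hlower y x (β.symm' h)⟩)
  refine Set.Subset.antisymm ?_ fun x hx => (iff_of_eq (hstack hx)).2 ⟨b, s.refl' b, rfl⟩
  rintro _ ⟨b', hb', rfl⟩
  exact stack_mid_of_middleRel hb'

theorem mem_interior_of_class_subset {b : B} (h : {x | stack α β x (mid b)} ⊆ Set.range mid) :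
    b ∈ interior α β := by
  constructor
  · rintro ⟨a, ha⟩
    obtain ⟨_, e⟩ := h (stack_upper (α.symm' ha))
    cases e
  · rintro ⟨c, hc⟩
    obtain ⟨_, e⟩ := h (stack_lower (β.symm' hc))
    cases e

theorem loops_eq_classesIn : loops α β = classesIn (middleRel α β) (interior α β) := by
  have hmid : (mid : B → A ⊕ B ⊕ C).Injective := Sum.inr_injective.comp Sum.inl_injective
  rw [loops, classesIn, classesIn, ← Set.ncard_image_of_injective _ hmid.image_injective]
  congr 1
  ext c
  constructor
  · rintro ⟨⟨x, rfl⟩, hc⟩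
    obtain ⟨b, rfl⟩ := hc ((stack α β).refl' x)
    have hb : {b' | middleRel α β b' b} ⊆ interior α β := fun b' hb' =>
      mem_interior_of_class_subset fun x hx =>
        hc ((stack α β).trans' hx (stack_mid_of_middleRel hb'))
    exact ⟨_, ⟨⟨b, rfl⟩, hb⟩, image_middleRel_class hb⟩
  · rintro ⟨_, ⟨⟨b, rfl⟩, hb⟩, rfl⟩
    exact ⟨⟨mid b, image_middleRel_class hb⟩, Set.image_subset_range _ _⟩

theorem loops_congr (hα : AllPairs α) (hα' : AllPairs α') (hβ : AllPairs β) (hβ' : AllPairs β')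
    (h : Setoid.comap Sum.inr α = Setoid.comap Sum.inr α')
    (h' : Setoid.comap Sum.inl β = Setoid.comap Sum.inl β') : loops α β = loops α' β' := by
  have hlo : ∀ b, (∃ a, α (Sum.inr b) (Sum.inl a)) ↔ ∃ a, α' (Sum.inr b) (Sum.inl a) := by
    intro b
    have hflip : Setoid.comap Sum.inl (flip α) = Setoid.comap Sum.inl (flip α') := h
    have := hα.flip.exists_rel_inr_iff b
    rwa [hflip, ← hα'.flip.exists_rel_inr_iff] at this
  have hup : ∀ b, (∃ c, β (Sum.inl b) (Sum.inr c)) ↔ ∃ c, β' (Sum.inl b) (Sum.inr c) := by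
    intro b
    rw [hβ.exists_rel_inr_iff, hβ'.exists_rel_inr_iff, h']
  simp only [loops_eq_classesIn, middleRel, interior, h, h', hlo, hup]

end Loops
end Diagram

namespace JonesMonoid
open Diagram
variable {n : ℕ}

theorem ext_rel {α β : JonesMonoid n} (h : α.1.rel = β.1.rel) : α = β :=
  Subtype.ext (PartitionMonoid.ext h)

theorem eq_of_le {α β : JonesMonoid n} (h : α.1.rel ≤ β.1.rel) : α = β :=
  ext_rel (α.2.1.eq_of_le β.2.1 h)

instance : Finite (JonesMonoid n) :=
  Finite.of_injective (fun α : JonesMonoid n => fun x y => α.1.rel x y) fun _ _ h =>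
    ext_rel (Setoid.ext fun x y => iff_of_eq (congrFun (congrFun h x) y))

instance : StarMul (JonesMonoid n) where
  star α := ⟨⟨flip α.1.rel⟩, α.2.1.flip, α.2.2.flip⟩
  star_involutive α := ext_rel (flip_flip α.1.rel)
  star_mul α β := ext_rel (flip_comp α.1.rel β.1.rel)

/-- The relation induced on the upper row: the paired-off upper vertices of `α`. -/
def upRel (α : JonesMonoid n) : Setoid (Fin n) := Setoid.comap Sum.inl α.1.rel

/-- The relation induced on the lower row: the paired-off lower vertices of `α`. -/
def loRel (α : JonesMonoid n) : Setoid (Fin n) := Setoid.comap Sum.inr α.1.rel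

/-- The upper vertices that are joined to the lower row. -/
def through (α : JonesMonoid n) : Set (Fin n) := {i | ∃ j, α.1.rel (Sum.inl i) (Sum.inr j)}

theorem upRel_star (α : JonesMonoid n) : upRel (star α) = loRel α := rfl

theorem loops_congr {α α' β β' : JonesMonoid n} (h : loRel α = loRel α')
    (h' : upRel β = upRel β') : loops α.1.rel β.1.rel = loops α'.1.rel β'.1.rel :=
  Diagram.loops_congr α.2.1 α'.2.1 β.2.1 β'.2.1 h h'

theorem mem_through_iff {α : JonesMonoid n} {i : Fin n} :
    i ∈ through α ↔ ∀ j, upRel α i j → j = i :=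
  α.2.1.exists_rel_inr_iff i

theorem rank_eq_ncard_through (α : JonesMonoid n) : α.1.rank = (through α).ncard := by
  symm
  refine Set.ncard_congr (fun i _ => {z | α.1.rel z (Sum.inl i)}) ?_ ?_ ?_
  · rintro i ⟨j, hj⟩
    exact ⟨⟨_, rfl⟩, ⟨i, α.1.rel.refl' _⟩, j, α.1.rel.symm' hj⟩
  · intro i i' hi _ h
    have hmem : Sum.inl i ∈ {z | α.1.rel z (Sum.inl i')} := h ▸ α.1.rel.refl' _
    exact (mem_through_iff.1 hi i' hmem).symm
  · rintro _ ⟨⟨x, rfl⟩, ⟨i, hi⟩, j, hj⟩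
    refine ⟨i, ⟨j, α.1.rel.trans' hi (α.1.rel.symm' hj)⟩, Set.ext fun z => ?_⟩
    exact ⟨fun h => α.1.rel.trans' h hi, fun h => α.1.rel.trans' h (α.1.rel.symm' hi)⟩

theorem rank_star_le (α : JonesMonoid n) : (star α).1.rank ≤ α.1.rank := by
  refine (Set.ncard_le_ncard ?_ (Set.toFinite _)).trans
    (Set.ncard_image_le (f := Set.preimage Sum.swap) (Set.toFinite _))
  rintro _ ⟨⟨x, rfl⟩, ⟨i, hi⟩, j, hj⟩
  exact ⟨{z | α.1.rel z x.swap}, ⟨⟨x.swap, rfl⟩, ⟨j, hj⟩, i, hi⟩, rfl⟩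

theorem rank_star (α : JonesMonoid n) : (star α).1.rank = α.1.rank := by
  refine le_antisymm (rank_star_le α) ?_
  conv_lhs => rw [← star_star α]
  exact rank_star_le (star α)

theorem rank_eq_of_upRel_eq {α β : JonesMonoid n} (h : upRel α = upRel β) :
    α.1.rank = β.1.rank := by
  have : through α = through β := Set.ext fun i => by rw [mem_through_iff, mem_through_iff, h]
  rw [rank_eq_ncard_through, rank_eq_ncard_through, this]

theorem rank_eq_of_loRel_eq {α β : JonesMonoid n} (h : loRel α = loRel β) :
    α.1.rank = β.1.rank := by
  rw [← rank_star α, ← rank_star β]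
  exact rank_eq_of_upRel_eq h

theorem rank_one : (1 : JonesMonoid n).1.rank = n := by
  have : through (1 : JonesMonoid n) = Set.univ := Set.eq_univ_of_forall fun i => ⟨i, rfl⟩
  rw [rank_eq_ncard_through, this, Set.ncard_univ, Nat.card_eq_fintype_card, Fintype.card_fin]

theorem rank_le (α : JonesMonoid n) : α.1.rank ≤ n := by
  rw [rank_eq_ncard_through]
  simpa using Set.ncard_le_card (through α)

theorem upRel_le_mul (α β : JonesMonoid n) : upRel α ≤ upRel (α * β) :=
  fun _ _ h => comp_inl_inl h

theorem loRel_le_mul (α β : JonesMonoid n) : loRel β ≤ loRel (α * β) :=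
  fun _ _ h => comp_inr_inr h

theorem through_mul_subset (α β : JonesMonoid n) : through (α * β) ⊆ through α := by
  intro i hi
  rw [mem_through_iff] at hi ⊢
  exact fun j hj => hi j (upRel_le_mul α β hj)

theorem rank_mul_le_left (α β : JonesMonoid n) : (α * β).1.rank ≤ α.1.rank := by
  rw [rank_eq_ncard_through, rank_eq_ncard_through]
  exact Set.ncard_le_ncard (through_mul_subset α β)

theorem rank_mul_le_right (α β : JonesMonoid n) : (α * β).1.rank ≤ β.1.rank := by
  rw [← rank_star, star_mul, ← rank_star β]
  exact rank_mul_le_left _ _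

theorem upRel_mul_of_rank_eq {α β : JonesMonoid n} (h : (α * β).1.rank = α.1.rank) :
    upRel (α * β) = upRel α := by
  have hthrough : through (α * β) = through α :=
    Set.eq_of_subset_of_ncard_le (through_mul_subset α β)
      (by rw [← rank_eq_ncard_through, ← rank_eq_ncard_through, h])
  refine le_antisymm (fun i j hij => ?_) (upRel_le_mul α β)
  rcases eq_or_ne j i with rfl | hji
  · exact (upRel α).refl' j
  · have hi : i ∉ through α := by
      rw [← hthrough, mem_through_iff]
      exact fun h => hji (h j hij)
    rw [mem_through_iff] at hi
    push Not at hi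
    obtain ⟨k, hik, hki⟩ := hi
    have hjk : Sum.inl j = Sum.inl k := (α * β).2.1.eq_of_rel hij (upRel_le_mul α β hik)
      (Sum.inl_injective.ne hji) (Sum.inl_injective.ne hki)
    exact Sum.inl_injective hjk ▸ hik

theorem loRel_mul_of_rank_eq {α β : JonesMonoid n} (h : (α * β).1.rank = β.1.rank) :
    loRel (α * β) = loRel β := by
  rw [← upRel_star, star_mul, ← upRel_star]
  exact upRel_mul_of_rank_eq (by rw [← star_mul, rank_star, rank_star, h])

theorem mul_star_mul_of_loRel_eq {α β : JonesMonoid n} (h : loRel β = loRel α) :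
    β * star α * α = β := by
  have hthrough : ∀ i j, β.1.rel (Sum.inl i) (Sum.inr j) →
      (β * star α * α).1.rel (Sum.inl i) (Sum.inr j) := by
    intro i j hij
    obtain ⟨k, hjk⟩ : j ∈ through (star α) := by
      rw [mem_through_iff, upRel_star, ← h, ← upRel_star, ← mem_through_iff]
      exact ⟨i, β.1.rel.symm' hij⟩
    exact comp_inl_inr (α := (β * star α).1.rel)
      (comp_inl_inr (β := (star α).1.rel) hij hjk) (α.1.rel.symm' hjk)
  refine (eq_of_le fun x y hxy => ?_).symm
  rcases x with i | i <;> rcases y with j | j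
  · exact upRel_le_mul _ _ (upRel_le_mul _ _ hxy)
  · exact hthrough i j hxy
  · exact Setoid.symm' _ (hthrough j i (β.1.rel.symm' hxy))
  · exact loRel_le_mul _ _ (h ▸ hxy : loRel α i j)

theorem mul_star_self_mul (α : JonesMonoid n) : α * star α * α = α :=
  mul_star_mul_of_loRel_eq rfl

theorem rank_mul_star_self (α : JonesMonoid n) : (α * star α).1.rank = α.1.rank := by
  refine le_antisymm (rank_mul_le_left _ _) ?_
  conv_lhs => rw [← mul_star_self_mul α]
  exact rank_mul_le_left _ _

end JonesMonoid

namespace Diagram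

section Path
variable {h h' : ℕ → ℕ} {N a b c : ℕ}

/-- Paths with steps `±1` on `[0, N]`. Since heights are natural numbers, they never go below
zero. -/
def UnitSteps (N : ℕ) (h : ℕ → ℕ) : Prop := ∀ i < N, h (i + 1) = h i + 1 ∨ h i = h (i + 1) + 1

/-- The height of the lower end of the step from `i` to `i + 1`. -/
def level (h : ℕ → ℕ) (i : ℕ) : ℕ := min (h i) (h (i + 1))

/-- The pairing of the steps of a path: two steps are related if they have the same level and the
path stays strictly above that level between them. -/
def arcs (h : ℕ → ℕ) : Setoid ℕ where
  r a b := level h a = level h b ∧ ∀ z, (a < z ∧ z ≤ b ∨ b < z ∧ z ≤ a) → level h a < h z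
  iseqv :=
    { refl := fun a => ⟨rfl, fun z hz => by omega⟩
      symm := fun h => ⟨h.1.symm, fun z hz => h.1 ▸ h.2 z (by omega)⟩
      trans := by
        rintro a b c ⟨hab, habove⟩ ⟨hbc, hbove⟩
        refine ⟨hab.trans hbc, fun z hz => ?_⟩
        by_cases hb : a < z ∧ z ≤ b ∨ b < z ∧ z ≤ a
        · exact habove z hb
        · exact hab ▸ hbove z (by omega) }

theorem level_eq_left (hup : h (a + 1) = h a + 1) : level h a = h a :=
  min_eq_left (by omega)

theorem level_eq_right (hdown : h a = h (a + 1) + 1) : level h a = h (a + 1) :=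
  min_eq_right (by omega)

theorem arcs_of_eqOn (heq : ∀ i ≤ N, h i = h' i) (ha : a < N) (hb : b < N) (hab : arcs h a b) :
    arcs h' a b := by
  have hlevel : ∀ i < N, level h i = level h' i := fun i hi => by
    rw [level, level, heq i hi.le, heq (i + 1) hi]
  refine ⟨by rw [← hlevel a ha, ← hlevel b hb, hab.1], fun z hz => ?_⟩
  rw [← hlevel a ha, ← heq z (by omega)]
  exact hab.2 z hz

theorem lt_iff_of_arcs (hab : arcs h a b) (hne : b ≠ a) : a < b ↔ h a < h (a + 1) := by
  have hlevel : level h a = h a ∨ level h a = h (a + 1) := min_choice _ _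
  rcases Nat.lt_or_gt_of_ne hne with hlt | hlt
  · have := hab.2 a (by omega)
    omega
  · have := hab.2 (a + 1) (by omega)
    omega

theorem arcs_unique (hab : arcs h a b) (hac : arcs h a c) (hb : b ≠ a) (hc : c ≠ a) : b = c := by
  by_contra hbc
  have hcb : arcs h c b := (arcs h).trans' ((arcs h).symm' hac) hab
  have := lt_iff_of_arcs hab hb
  have := lt_iff_of_arcs hac hc
  have := lt_iff_of_arcs hcb hbc
  have := lt_iff_of_arcs ((arcs h).symm' hab) hb.symm
  have := lt_iff_of_arcs ((arcs h).symm' hac) hc.symm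
  have := lt_iff_of_arcs ((arcs h).symm' hcb) (Ne.symm hbc)
  omega

theorem exists_arcs_of_up (hs : UnitSteps N h) (hN : h N = 0) (ha : a < N)
    (hup : h (a + 1) = h a + 1) : ∃ b, a < b ∧ b < N ∧ arcs h a b := by
  classical
  have hex : ∃ z, a ≤ z ∧ z < N ∧ h (z + 1) ≤ h a :=
    ⟨N - 1, by omega, by omega, by rw [Nat.sub_add_cancel (by omega)]; omega⟩
  obtain ⟨hab, hbN, hb⟩ := Nat.find_spec hex
  have hmin := fun m (hm : m < Nat.find hex) => Nat.find_min hex hm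
  generalize Nat.find hex = b at *
  have habove : ∀ z, a < z → z ≤ b → h a < h z := fun z haz hzb => by
    have := hmin (z - 1) (by omega)
    rw [Nat.sub_add_cancel (by omega)] at this
    omega
  have hlt : a < b := lt_of_le_of_ne hab (by rintro rfl; omega)
  have := habove b hlt le_rfl
  have hdown := (hs b hbN).resolve_left (by omega)
  have hlevel := level_eq_left hup
  refine ⟨b, hlt, hbN, ?_, fun z hz => ?_⟩
  · rw [hlevel, level_eq_right hdown]
    omega
  · have := habove z (by omega) (by omega)
    omega

theorem exists_arcs_of_down (hs : UnitSteps N h) (h0 : h 0 = 0) (ha : a < N)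
    (hdown : h a = h (a + 1) + 1) : ∃ b, b < a ∧ arcs h a b := by
  classical
  let P : ℕ → Prop := fun z => h z ≤ h (a + 1)
  have hb : P (Nat.findGreatest P a) := Nat.findGreatest_spec (Nat.zero_le a) (by simp [P, h0])
  have habove : ∀ z, Nat.findGreatest P a < z → z ≤ a → ¬ P z := fun z =>
    Nat.findGreatest_is_greatest
  have hba := Nat.findGreatest_le (P := P) a
  generalize Nat.findGreatest P a = b at *
  simp only [P, not_le] at hb habove
  have hlt : b < a := lt_of_le_of_ne hba (by rintro rfl; omega)
  have := habove (b + 1) (by omega) (by omega)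
  have hup := (hs b (by omega)).resolve_right (by omega)
  have hlevel := level_eq_right hdown
  refine ⟨b, hlt, ?_, fun z hz => ?_⟩
  · rw [hlevel, level_eq_left hup]
    omega
  · have := habove z (by omega) (by omega)
    omega

end Path

section OfPath
variable {n : ℕ} {h : ℕ → ℕ}

theorem exists_circ_eq {i : ℕ} (hi : i < 2 * n) : ∃ x : Fin n ⊕ Fin n, circ x = i := by
  rcases Nat.lt_or_ge i n with hin | hin
  · exact ⟨Sum.inl ⟨i, hin⟩, rfl⟩
  · refine ⟨Sum.inr ⟨2 * n - 1 - i, by omega⟩, ?_⟩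
    simp only [circ, Sum.elim_inr]
    omega

/-- The diagram of a path of length `2 * n`: its blocks are the arcs of the path, whose steps are
numbered by the boundary of the rectangle. -/
def ofPath (n : ℕ) (h : ℕ → ℕ) : Setoid (Fin n ⊕ Fin n) := Setoid.comap circ (arcs h)

theorem allPairs_ofPath (hs : UnitSteps (2 * n) h) (h0 : h 0 = 0) (hN : h (2 * n) = 0) :
    AllPairs (ofPath n h) := by
  rw [allPairs_iff]
  intro x
  have hx := circ_lt x
  obtain ⟨b, hbx, hb, harc⟩ : ∃ b, b ≠ circ x ∧ b < 2 * n ∧ arcs h (circ x) b := by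
    rcases hs _ hx with hup | hdown
    · obtain ⟨b, hlt, hb, harc⟩ := exists_arcs_of_up hs hN hx hup
      exact ⟨b, hlt.ne', hb, harc⟩
    · obtain ⟨b, hlt, harc⟩ := exists_arcs_of_down hs h0 hx hdown
      exact ⟨b, hlt.ne, hlt.trans hx, harc⟩
  obtain ⟨y, rfl⟩ := exists_circ_eq hb
  refine ⟨y, ne_of_apply_ne circ hbx, fun z => ⟨fun hz => ?_, ?_⟩⟩
  · refine or_iff_not_imp_left.2 fun hzx => circ_injective ?_
    exact arcs_unique hz harc (circ_injective.ne hzx) hbx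
  · rintro (rfl | rfl)
    · exact Setoid.refl' _ _
    · exact harc

theorem planar_ofPath (h : ℕ → ℕ) : Planar (ofPath n h) := by
  intro a b c d hab hbc hcd hac hbd
  exfalso
  have hlac := hac.1
  have hlbd := hbd.1
  have hlb : level h (circ b) = h (circ b) ∨ level h (circ b) = h (circ b + 1) := min_choice _ _
  have hlc : level h (circ c) = h (circ c) ∨ level h (circ c) = h (circ c + 1) := min_choice _ _
  have := hac.2 (circ b) (by omega)
  have := hac.2 (circ b + 1) (by omega)
  have := hbd.2 (circ c) (by omega)
  have := hbd.2 (circ c + 1) (by omega)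
  omega

end OfPath

section Height
variable {n : ℕ} {α : Setoid (Fin n ⊕ Fin n)}

/-- The first ends of the blocks that join the first `i` boundary points to the others. -/
def crossing (α : Setoid (Fin n ⊕ Fin n)) (i : ℕ) : Set (Fin n ⊕ Fin n) :=
  {x | circ x < i ∧ ∃ y, i ≤ circ y ∧ α x y}

/-- The path of a diagram: the number of blocks that cross a given position of the boundary. -/
noncomputable def height (α : Setoid (Fin n ⊕ Fin n)) (i : ℕ) : ℕ := (crossing α i).ncard

theorem height_zero (α : Setoid (Fin n ⊕ Fin n)) : height α 0 = 0 := by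
  have : crossing α 0 = ∅ := Set.eq_empty_of_forall_notMem fun x hx => Nat.not_lt_zero _ hx.1
  rw [height, this, Set.ncard_empty]

theorem height_last (α : Setoid (Fin n ⊕ Fin n)) : height α (2 * n) = 0 := by
  have : crossing α (2 * n) = ∅ :=
    Set.eq_empty_of_forall_notMem fun x ⟨_, y, hy, _⟩ => hy.not_gt (circ_lt y)
  rw [height, this, Set.ncard_empty]

theorem AllPairs.circ_eq_iff (hα : AllPairs α) {x y u v : Fin n ⊕ Fin n} (hxy : α x y)
    (huv : α u v) (hne : circ x ≠ circ y) (hne' : circ u ≠ circ v) :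
    circ u = circ x ↔ circ v = circ y := by
  constructor
  · intro hux
    obtain rfl := circ_injective hux
    rw [hα.eq_of_rel huv hxy (ne_of_apply_ne circ hne'.symm) (ne_of_apply_ne circ hne.symm)]
  · intro hvy
    obtain rfl := circ_injective hvy
    rw [hα.eq_of_rel (α.symm' huv) (α.symm' hxy) (ne_of_apply_ne circ hne')
      (ne_of_apply_ne circ hne)]

variable {x y : Fin n ⊕ Fin n}

theorem crossing_succ_of_lt (hα : AllPairs α) (hlt : circ x < circ y) (hxy : α x y) :
    crossing α (circ x + 1) = insert x (crossing α (circ x)) := by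
  ext z
  rw [Set.mem_insert_iff]
  constructor
  · rintro ⟨hz, w, hw, hzw⟩
    refine or_iff_not_imp_left.2 fun hzx => ?_
    have := circ_injective.ne hzx
    exact ⟨by omega, w, by omega, hzw⟩
  · rintro (rfl | ⟨hz, w, hw, hzw⟩)
    · exact ⟨by omega, y, hlt, hxy⟩
    · have := hα.circ_eq_iff (α.symm' hxy) hzw (by omega) (by omega)
      exact ⟨by omega, w, by omega, hzw⟩

theorem crossing_of_gt (hα : AllPairs α) (hlt : circ y < circ x) (hxy : α x y) :
    crossing α (circ x) = insert y (crossing α (circ x + 1)) := by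
  ext z
  rw [Set.mem_insert_iff]
  constructor
  · rintro ⟨hz, w, hw, hzw⟩
    have := hα.circ_eq_iff (α.symm' hxy) hzw (by omega) (by omega)
    refine or_iff_not_imp_left.2 fun hzy => ?_
    have := circ_injective.ne hzy
    exact ⟨by omega, w, by omega, hzw⟩
  · rintro (rfl | ⟨hz, w, hw, hzw⟩)
    · exact ⟨hlt, x, le_rfl, α.symm' hxy⟩
    · have := hα.circ_eq_iff hxy hzw (by omega) (by omega)
      have := hα.circ_eq_iff (α.symm' hxy) hzw (by omega) (by omega)
      exact ⟨by omega, w, by omega, hzw⟩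

theorem height_succ_of_lt (hα : AllPairs α) (hlt : circ x < circ y) (hxy : α x y) :
    height α (circ x + 1) = height α (circ x) + 1 := by
  rw [height, crossing_succ_of_lt hα hlt hxy,
    Set.ncard_insert_of_notMem fun hx => lt_irrefl _ hx.1, height]

theorem height_of_gt (hα : AllPairs α) (hlt : circ y < circ x) (hxy : α x y) :
    height α (circ x) = height α (circ x + 1) + 1 := by
  have hy : y ∉ crossing α (circ x + 1) := by
    rintro ⟨-, w, hw, hyw⟩
    have := hα.circ_eq_iff (α.symm' hxy) hyw (by omega) (by omega)
    omega
  rw [height, crossing_of_gt hα hlt hxy, Set.ncard_insert_of_notMem hy, height]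

theorem unitSteps_height (hα : AllPairs α) : UnitSteps (2 * n) (height α) := by
  intro i hi
  obtain ⟨x, rfl⟩ := exists_circ_eq hi
  obtain ⟨y, hy, hxy⟩ := hα.exists_rel x
  rcases Nat.lt_or_gt_of_ne (circ_injective.ne hy) with hlt | hlt
  · exact Or.inr (height_of_gt hα hlt hxy)
  · exact Or.inl (height_succ_of_lt hα hlt hxy)

theorem height_ofPath {h : ℕ → ℕ} (hs : UnitSteps (2 * n) h) (h0 : h 0 = 0)
    (hN : h (2 * n) = 0) {i : ℕ} (hi : i ≤ 2 * n) : height (ofPath n h) i = h i := by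
  have hp := allPairs_ofPath hs h0 hN
  induction i with
  | zero => rw [height_zero, h0]
  | succ i ih =>
    specialize ih (by omega)
    obtain ⟨x, rfl⟩ := exists_circ_eq (n := n) (i := i) (by omega)
    rcases hs _ (circ_lt x) with hup | hdown
    · obtain ⟨b, hlt, hb, harc⟩ := exists_arcs_of_up hs hN (circ_lt x) hup
      obtain ⟨y, rfl⟩ := exists_circ_eq hb
      rw [height_succ_of_lt hp hlt harc, ih, hup]
    · obtain ⟨b, hlt, harc⟩ := exists_arcs_of_down hs h0 (circ_lt x) hdown
      obtain ⟨y, rfl⟩ := exists_circ_eq (n := n) (i := b) (by omega)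
      have := height_of_gt hp hlt harc
      omega

section Nested
variable (hα : AllPairs α) (pα : Planar α) (hlt : circ x < circ y) (hxy : α x y)
include hα pα hlt hxy

theorem circ_lt_of_rel_of_lt {u v : Fin n ⊕ Fin n} (huv : α u v) (hu : circ u < circ x)
    (hv : circ x ≤ circ v) : circ y < circ v := by
  have := hα.circ_eq_iff hxy huv (by omega) (by omega)
  have := hα.circ_eq_iff (α.symm' hxy) huv (by omega) (by omega)
  by_contra hvy
  have hux : α u x := pα u x v y hu (by omega) (by omega) huv hxy
  have := hα.circ_eq_iff (α.symm' hxy) hux (by omega) (by omega)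
  omega

theorem lt_circ_of_rel_of_gt {u v : Fin n ⊕ Fin n} (huv : α u v) (hu : circ u ≤ circ y)
    (hv : circ y < circ v) : circ u < circ x := by
  have := hα.circ_eq_iff hxy huv (by omega) (by omega)
  have := hα.circ_eq_iff (α.symm' hxy) huv (by omega) (by omega)
  by_contra hux
  have hxu : α x u := pα x u y v (by omega) (by omega) hv hxy huv
  have := hα.circ_eq_iff hxy hxu (by omega) (by omega)
  omega

theorem crossing_succ_eq_crossing : crossing α (circ y + 1) = crossing α (circ x) := by
  ext u
  constructor
  · rintro ⟨hu, v, hv, huv⟩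
    have := lt_circ_of_rel_of_gt hα pα hlt hxy huv (by omega) (by omega)
    exact ⟨this, v, by omega, huv⟩
  · rintro ⟨hu, v, hv, huv⟩
    have := circ_lt_of_rel_of_lt hα pα hlt hxy huv hu hv
    exact ⟨by omega, v, this, huv⟩

theorem crossing_ssubset_crossing {z : ℕ} (hxz : circ x < z) (hzy : z ≤ circ y) :
    crossing α (circ x) ⊂ crossing α z := by
  refine (Set.ssubset_iff_of_subset ?_).2 ⟨x, ⟨hxz, y, hzy, hxy⟩, fun hx => lt_irrefl _ hx.1⟩
  rintro u ⟨hu, v, hv, huv⟩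
  have := circ_lt_of_rel_of_lt hα pα hlt hxy huv hu hv
  exact ⟨by omega, v, by omega, huv⟩

end Nested

theorem ofPath_height (hα : AllPairs α) (pα : Planar α) : ofPath n (height α) = α := by
  have hpath := allPairs_ofPath (unitSteps_height hα) (height_zero α) (height_last α)
  refine (hα.eq_of_le hpath fun x y hxy => ?_).symm
  wlog hlt : circ x < circ y generalizing x y
  · rcases Nat.lt_or_ge (circ y) (circ x) with hgt | hge
    · exact Setoid.symm' _ (this _ _ (α.symm' hxy) hgt)
    · rw [circ_injective (le_antisymm hge (not_lt.1 hlt))]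
  have hlx : level (height α) (circ x) = height α (circ x) :=
    level_eq_left (height_succ_of_lt hα hlt hxy)
  have hly : level (height α) (circ y) = height α (circ x) := by
    rw [level_eq_right (height_of_gt hα hlt (α.symm' hxy)), height,
      crossing_succ_eq_crossing hα pα hlt hxy, height]
  refine ⟨hlx.trans hly.symm, fun z hz => ?_⟩
  rw [hlx]
  exact Set.ncard_lt_ncard (crossing_ssubset_crossing hα pα hlt hxy (by omega) (by omega))

theorem height_flip (hα : AllPairs α) {i : ℕ} (hi : i ≤ 2 * n) :
    height (flip α) i = height α (2 * n - i) := by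
  obtain ⟨p, hp, -, hrel⟩ := hα.exists_partner
  have hpartner : ∀ {x y}, α x y → circ x ≠ circ y → p x = y := fun hxy hne =>
    (((hrel _ _).1 hxy).resolve_left fun h => hne (congrArg circ h.symm)).symm
  refine Set.ncard_congr (fun x _ => p x.swap) ?_ ?_ ?_
  · rintro x ⟨hx, y, hy, hxy⟩
    have := circ_swap x
    have := circ_swap y
    have := circ_lt x
    have := circ_lt y
    rw [hpartner hxy (by omega)]
    exact ⟨by omega, x.swap, by omega, α.symm' hxy⟩
  · exact fun x y _ _ hxy => Sum.swap_leftInverse.injective (hp.injective hxy)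
  · rintro x ⟨hx, y, hy, hxy⟩
    have := circ_swap x
    have := circ_swap y
    have := circ_lt x
    have := circ_lt y
    refine ⟨y.swap, ⟨by omega, x.swap, by omega, flip_swap (α.symm' hxy)⟩, ?_⟩
    · rw [Sum.swap_swap, hpartner (α.symm' hxy) (by omega)]

end Height
end Diagram

namespace JonesMonoid
open Diagram
variable {n : ℕ} {α β : JonesMonoid n}

/-- The planar pairing of a path. -/
def ofPath {h : ℕ → ℕ} (hs : UnitSteps (2 * n) h) (h0 : h 0 = 0) (hN : h (2 * n) = 0) :
    JonesMonoid n :=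
  ⟨⟨Diagram.ofPath n h⟩, allPairs_ofPath hs h0 hN, planar_ofPath h⟩

theorem ncard_upRel_eq_height (α : JonesMonoid n) {i : ℕ} (hi : i ≤ n) :
    {x : Fin n | (x : ℕ) < i ∧ ∀ j : Fin n, (j : ℕ) < i → upRel α x j → j = x}.ncard =
      height α.1.rel i := by
  refine Set.ncard_congr (fun x _ => Sum.inl x) ?_ (fun x y _ _ h => Sum.inl_injective h) ?_
  · rintro x ⟨hx, hpair⟩
    obtain ⟨y, hyx, hxy⟩ := α.2.1.exists_rel (Sum.inl x)
    refine ⟨hx, y, ?_, hxy⟩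
    rcases y with j | j
    · by_contra hj
      exact hyx (congrArg _ (hpair j (not_le.1 hj) hxy))
    · simp only [circ, Sum.elim_inr]
      omega
  · rintro (x | x) ⟨hx, y, hy, hxy⟩
    · refine ⟨x, ⟨hx, fun j hj hxj => ?_⟩, rfl⟩
      by_contra hjx
      have hyj : y = Sum.inl j := α.2.1.eq_of_rel hxy hxj
        (by rintro rfl; omega) (Sum.inl_injective.ne hjx)
      rw [hyj] at hy
      exact hy.not_gt hj
    · simp only [circ, Sum.elim_inr] at hx
      omega

theorem height_eq_of_upRel_eq (h : upRel α = upRel β) {i : ℕ} (hi : i ≤ n) :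
    height α.1.rel i = height β.1.rel i := by
  rw [← ncard_upRel_eq_height α hi, ← ncard_upRel_eq_height β hi, h]

theorem height_star (α : JonesMonoid n) {i : ℕ} (hi : i ≤ 2 * n) :
    height (star α).1.rel i = height α.1.rel (2 * n - i) :=
  height_flip α.2.1 hi

theorem height_mid (α : JonesMonoid n) : height α.1.rel n = α.1.rank := by
  rw [← ncard_upRel_eq_height α le_rfl, rank_eq_ncard_through]
  congr 1
  ext x
  rw [mem_through_iff]
  simp only [Set.mem_ofPred_eq, Fin.is_lt, true_and, forall_true_left]

theorem ext_height (h : ∀ i ≤ 2 * n, height α.1.rel i = height β.1.rel i) : α = β := by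
  refine eq_of_le fun x y hxy => ?_
  rw [← ofPath_height α.2.1 α.2.2] at hxy
  rw [← ofPath_height β.2.1 β.2.2]
  exact arcs_of_eqOn h (circ_lt x) (circ_lt y) hxy

theorem ext_upRel_loRel (hup : upRel α = upRel β) (hlo : loRel α = loRel β) : α = β := by
  refine ext_height fun i hi => ?_
  rcases Nat.lt_or_ge n i with hni | hin
  · rw [← star_star α, ← star_star β, height_star _ hi, height_star _ hi]
    exact height_eq_of_upRel_eq (α := star α) (β := star β) hlo (by omega)
  · exact height_eq_of_upRel_eq hup hin

theorem upRel_le_of_height_eq (h : ∀ i ≤ n, height α.1.rel i = height β.1.rel i) :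
    upRel α ≤ upRel β := by
  intro x y hxy
  have hpath : Diagram.ofPath n (height β.1.rel) (Sum.inl x) (Sum.inl y) :=
    arcs_of_eqOn h x.2 y.2 (by
      change Diagram.ofPath n (height α.1.rel) (Sum.inl x) (Sum.inl y)
      rwa [ofPath_height α.2.1 α.2.2])
  rwa [ofPath_height β.2.1 β.2.2] at hpath

theorem upRel_eq_of_height_eq (h : ∀ i ≤ n, height α.1.rel i = height β.1.rel i) :
    upRel α = upRel β :=
  le_antisymm (upRel_le_of_height_eq h) (upRel_le_of_height_eq fun i hi => (h i hi).symm)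

end JonesMonoid

namespace Diagram

theorem UnitSteps.le {h : ℕ → ℕ} {N i : ℕ} (hs : UnitSteps N h) (h0 : h 0 = 0) (hi : i ≤ N) :
    h i ≤ i := by
  induction i with
  | zero => exact h0.le
  | succ i ih =>
    have := ih (by omega)
    rcases hs i hi with hup | hdown <;> omega

theorem UnitSteps.mono {h : ℕ → ℕ} {M N : ℕ} (hs : UnitSteps N h) (hMN : M ≤ N) : UnitSteps M h :=
  fun i hi => hs i (hi.trans_le hMN)

/-- Ballot paths: the paths with `n` unit steps from height `0` to height `r` that never go below
zero. -/
def ballotPaths (n r : ℕ) : Set (Fin (n + 1) → ℕ) :=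
  (fun h i => h i) '' {h : ℕ → ℕ | h 0 = 0 ∧ UnitSteps n h ∧ h n = r}

variable {n r k : ℕ}

theorem ballotPaths_finite (n r : ℕ) : (ballotPaths n r).Finite := by
  refine (Set.Finite.pi fun _ : Fin (n + 1) => Set.finite_Iic n).subset ?_
  rintro _ ⟨h, ⟨h0, hs, -⟩, rfl⟩ i -
  exact (hs.le h0 i.is_le).trans i.is_le

theorem ballotPaths_eq_empty_of_lt (hnr : n < r) : ballotPaths n r = ∅ := by
  refine Set.eq_empty_of_forall_notMem ?_
  rintro _ ⟨h, ⟨h0, hs, rfl⟩, -⟩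
  exact hnr.not_ge (hs.le h0 le_rfl)

theorem ballotPaths_zero_zero : ballotPaths 0 0 = {0} := by
  ext p
  constructor
  · rintro ⟨h, ⟨h0, -⟩, rfl⟩
    exact funext fun i => by rw [Fin.eq_zero i]; exact h0
  · rintro rfl
    exact ⟨0, ⟨rfl, fun i hi => absurd hi (Nat.not_lt_zero i), rfl⟩, rfl⟩

theorem mem_ballotPaths_succ_iff {p : Fin (n + 2) → ℕ} :
    p ∈ ballotPaths (n + 1) r ↔
      ∃ s, (s = r + 1 ∨ s + 1 = r) ∧
        ∃ q ∈ ballotPaths n s, (Fin.snoc q r : Fin (n + 2) → ℕ) = p := by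
  constructor
  · rintro ⟨h, ⟨h0, hs, rfl⟩, rfl⟩
    refine ⟨h n, ?_, fun i => h i, ⟨h, ⟨h0, hs.mono n.le_succ, rfl⟩, rfl⟩, ?_⟩
    · rcases hs n n.lt_succ_self with hup | hdown <;> omega
    · exact Fin.snoc_init_self (α := fun _ => ℕ) fun i : Fin (n + 2) => h i
  · rintro ⟨s, hsr, _, ⟨h, ⟨h0, hs, rfl⟩, rfl⟩, rfl⟩
    have hold : ∀ i ≤ n, Function.update h (n + 1) r i = h i := fun i hi =>
      Function.update_of_ne (by omega) _ _
    have hnew : Function.update h (n + 1) r (n + 1) = r := Function.update_self _ _ _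
    refine ⟨Function.update h (n + 1) r, ⟨by rw [hold 0 n.zero_le, h0], fun i hi => ?_, hnew⟩, ?_⟩
    · rcases Nat.lt_succ_iff_lt_or_eq.1 hi with hin | rfl
      · rw [hold i hin.le, hold (i + 1) hin]
        exact hs i hin
      · rw [hold i le_rfl, hnew]
        omega
    · funext i
      refine Fin.lastCases ?_ (fun j => ?_) i
      · exact hnew.trans (Fin.snoc_last (α := fun _ => ℕ) _ _).symm
      · exact (hold j j.is_le).trans (Fin.snoc_castSucc (α := fun _ => ℕ) r (fun i => h i) j).symm

theorem ncard_image_snoc (s : Set (Fin (n + 1) → ℕ)) (r : ℕ) :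
    ((fun q => (Fin.snoc q r : Fin (n + 2) → ℕ)) '' s).ncard = s.ncard :=
  Set.ncard_image_of_injective s (Fin.snoc_left_injective (α := fun _ => ℕ) r)

theorem ncard_ballotPaths_succ_zero (n : ℕ) :
    (ballotPaths (n + 1) 0).ncard = (ballotPaths n 1).ncard := by
  have himage : ballotPaths (n + 1) 0 =
      (fun q => (Fin.snoc q 0 : Fin (n + 2) → ℕ)) '' ballotPaths n 1 :=
    Set.ext fun p => by simp [mem_ballotPaths_succ_iff]
  rw [himage, ncard_image_snoc]

theorem ncard_ballotPaths_succ_succ (n r : ℕ) :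
    (ballotPaths (n + 1) (r + 1)).ncard =
      (ballotPaths n (r + 2)).ncard + (ballotPaths n r).ncard := by
  have hdisj : Disjoint (ballotPaths n (r + 2)) (ballotPaths n r) := by
    rw [Set.disjoint_left]
    rintro _ ⟨h, ⟨-, -, hn⟩, rfl⟩ ⟨h', ⟨-, -, hn'⟩, hhh⟩
    have := congrFun hhh (Fin.last n)
    simp only [Fin.val_last] at this
    omega
  have himage : ballotPaths (n + 1) (r + 1) =
      (fun q => (Fin.snoc q (r + 1) : Fin (n + 2) → ℕ)) ''
        (ballotPaths n (r + 2) ∪ ballotPaths n r) :=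
    Set.ext fun p => by simp [mem_ballotPaths_succ_iff, or_and_right, exists_or]
  rw [himage, ncard_image_snoc,
    Set.ncard_union_eq hdisj (ballotPaths_finite _ _) (ballotPaths_finite _ _)]

theorem ncard_ballotPaths_self (n : ℕ) : (ballotPaths n n).ncard = 1 := by
  induction n with
  | zero => rw [ballotPaths_zero_zero, Set.ncard_singleton]
  | succ n ih =>
    rw [ncard_ballotPaths_succ_succ, ih, ballotPaths_eq_empty_of_lt (by omega), Set.ncard_empty]

theorem ballot_recurrence {X Y : ℕ} (hn : r + 2 * k + 1 = n)
    (hX : (n + 1) * X = (r + 2) * (n + 1).choose k)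
    (hY : (n + 1) * Y = r * (n + 1).choose (k + 1)) :
    (n + 2) * (X + Y) = (r + 1) * (n + 2).choose (k + 1) := by
  subst hn
  have hchoose := Nat.choose_succ_right_eq (r + 2 * k + 1 + 1) k
  rw [show r + 2 * k + 1 + 1 - k = r + k + 2 by omega] at hchoose
  refine Nat.eq_of_mul_eq_mul_left (Nat.succ_pos (r + 2 * k + 1)) ?_
  rw [Nat.choose_succ_succ' (r + 2 * k + 1 + 1) k, Nat.succ_eq_add_one]
  zify at *
  linear_combination (r + 2 * k + 3 : ℤ) * (hX + hY) - 2 * hchoose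

theorem ncard_ballotPaths (h : r + 2 * k = n) :
    (n + 1) * (ballotPaths n r).ncard = (r + 1) * (n + 1).choose k := by
  induction n generalizing r k with
  | zero =>
    obtain ⟨rfl, rfl⟩ : r = 0 ∧ k = 0 := by omega
    simp [ballotPaths_zero_zero]
  | succ n ih =>
    rcases k with _ | k
    · obtain rfl : r = n + 1 := by omega
      rw [ncard_ballotPaths_self, Nat.choose_zero_right]
    · have hX := ih (r := r + 1) (k := k) (by omega)
      rcases r with _ | r
      · rw [ncard_ballotPaths_succ_zero]
        exact ballot_recurrence (Y := 0) (by omega) hX (by simp)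
      · rw [ncard_ballotPaths_succ_succ]
        exact ballot_recurrence (by omega) hX (ih (by omega))

theorem cast_ncard_ballotPaths (h : r + 2 * k = n) :
    ((ballotPaths n r).ncard : ℚ) = ((r : ℚ) + 1) / ((n : ℚ) + 1) * ((n + 1).choose k : ℚ) := by
  have hcast : ((n : ℚ) + 1) * (ballotPaths n r).ncard = ((r : ℚ) + 1) * (n + 1).choose k := by
    exact_mod_cast ncard_ballotPaths h
  rw [div_mul_eq_mul_div, eq_div_iff (by positivity), mul_comm, hcast]

theorem ballotPaths_nonempty (h : r + 2 * k = n) : (ballotPaths n r).Nonempty := by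
  refine Set.nonempty_of_ncard_ne_zero fun hzero => ?_
  have hcard := ncard_ballotPaths h
  rw [hzero, mul_zero] at hcard
  exact (Nat.mul_pos r.succ_pos (Nat.choose_pos (by omega))).ne hcard

end Diagram

namespace JonesMonoid
open Diagram
variable {n : ℕ}

/-- The first half of the path of a diagram, which describes its upper row. -/
noncomputable def upPath (α : JonesMonoid n) (i : Fin (n + 1)) : ℕ := height α.1.rel i

theorem upPath_mem_ballotPaths (α : JonesMonoid n) : upPath α ∈ ballotPaths n α.1.rank :=
  ⟨height α.1.rel,
    ⟨height_zero _, (unitSteps_height α.2.1).mono (by omega), height_mid α⟩, rfl⟩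

theorem upPath_eq_iff {α β : JonesMonoid n} : upPath α = upPath β ↔ upRel α = upRel β :=
  ⟨fun h => upRel_eq_of_height_eq fun i hi => congrFun h ⟨i, Nat.lt_succ_of_le hi⟩,
    fun h => funext fun i => height_eq_of_upRel_eq h i.is_le⟩

theorem exists_upPath_eq {r : ℕ} {p q : Fin (n + 1) → ℕ} (hp : p ∈ ballotPaths n r)
    (hq : q ∈ ballotPaths n r) :
    ∃ α : JonesMonoid n, α.1.rank = r ∧ upPath α = p ∧ upPath (star α) = q := by
  obtain ⟨f, ⟨f0, fs, fn⟩, rfl⟩ := hp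
  obtain ⟨g, ⟨g0, gs, gn⟩, rfl⟩ := hq
  let h : ℕ → ℕ := fun i => if i ≤ n then f i else g (2 * n - i)
  have hleft : ∀ i ≤ n, h i = f i := fun i hi => if_pos hi
  have hright : ∀ i, n ≤ i → h i = g (2 * n - i) := by
    intro i hi
    rcases hi.eq_or_lt with rfl | hi
    · rw [hleft n le_rfl, show 2 * n - n = n by omega, fn, gn]
    · exact if_neg (by omega)
  have hs : UnitSteps (2 * n) h := by
    intro i hi
    rcases Nat.lt_or_ge i n with hin | hni
    · rw [hleft i hin.le, hleft (i + 1) hin]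
      exact fs i hin
    · rw [hright i hni, hright (i + 1) (by omega)]
      have := gs (2 * n - (i + 1)) (by omega)
      rw [show 2 * n - (i + 1) + 1 = 2 * n - i by omega] at this
      exact this.symm
  have h0 : h 0 = 0 := by rw [hleft 0 n.zero_le, f0]
  have hN : h (2 * n) = 0 := by rw [hright _ (by omega), Nat.sub_self, g0]
  have hheight : ∀ i ≤ 2 * n, height (ofPath hs h0 hN).1.rel i = h i := fun i =>
    height_ofPath hs h0 hN
  refine ⟨ofPath hs h0 hN, ?_, funext fun i => ?_, funext fun i => ?_⟩
  · rw [← height_mid, hheight n (by omega), hleft n le_rfl, fn]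
  · rw [upPath, hheight i (by omega), hleft i i.is_le]
  · rw [upPath, height_star _ (by omega), hheight _ (by omega), hright _ (by omega)]
    congr 1
    omega

theorem exists_upRel_eq_loRel_eq {α β : JonesMonoid n} (h : α.1.rank = β.1.rank) :
    ∃ γ : JonesMonoid n, upRel γ = upRel α ∧ loRel γ = loRel β := by
  have hβ := upPath_mem_ballotPaths (star β)
  rw [rank_star, ← h] at hβ
  obtain ⟨γ, -, hup, hlo⟩ := exists_upPath_eq (upPath_mem_ballotPaths α) hβ
  exact ⟨γ, upPath_eq_iff.1 hup, upPath_eq_iff.1 hlo⟩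

theorem exists_rank_eq {r k : ℕ} (h : r + 2 * k = n) : ∃ α : JonesMonoid n, α.1.rank = r := by
  obtain ⟨p, hp⟩ := ballotPaths_nonempty h
  obtain ⟨α, hα, -⟩ := exists_upPath_eq hp hp
  exact ⟨α, hα⟩

end JonesMonoid

namespace JonesMonoid
open Diagram
variable {n i : ℕ}

section Hook

/-- The path of the hook diagram: the path `0, 1, …, n, …, 1, 0` of the identity with an extra
peak at height `i + 1` on either side. -/
def hookPath (n i j : ℕ) : ℕ :=
  if min j (2 * n - j) ≤ i + 1 then min j (2 * n - j) else min j (2 * n - j) - 2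

theorem unitSteps_hookPath (hi : i + 1 < n) : UnitSteps (2 * n) (hookPath n i) := by
  intro j hj
  unfold hookPath
  split_ifs <;> omega

theorem hookPath_zero (n i : ℕ) : hookPath n i 0 = 0 := by
  simp [hookPath]

theorem hookPath_last (n i : ℕ) : hookPath n i (2 * n) = 0 := by
  simp [hookPath]

/-- The standard generators of the Jones monoid: `hook i` joins `i` to `i + 1` in both rows, and
every other vertex to the opposite one. -/
def hook (i : ℕ) (hi : i + 1 < n) : JonesMonoid n :=
  ofPath (unitSteps_hookPath hi) (hookPath_zero n i) (hookPath_last n i)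

theorem star_hook (hi : i + 1 < n) : star (hook i hi) = hook i hi := by
  have hheight : ∀ j ≤ 2 * n, height (hook i hi).1.rel j = hookPath n i j := fun j hj =>
    height_ofPath (unitSteps_hookPath hi) (hookPath_zero n i) (hookPath_last n i) hj
  refine ext_height fun j hj => ?_
  rw [height_star _ hj, hheight j hj, hheight _ (by omega), hookPath, hookPath,
    Nat.sub_sub_self hj, min_comm]

theorem upRel_hook (hi : i + 1 < n) :
    upRel (hook i hi) ⟨i, Nat.lt_of_succ_lt hi⟩ ⟨i + 1, hi⟩ := by
  change arcs (hookPath n i) i (i + 1)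
  refine ⟨?_, fun z hz => ?_⟩
  · simp only [level, hookPath]
    split_ifs <;> omega
  · simp only [level, hookPath]
    split_ifs <;> omega

theorem loRel_hook (hi : i + 1 < n) :
    loRel (hook i hi) ⟨i, Nat.lt_of_succ_lt hi⟩ ⟨i + 1, hi⟩ := by
  rw [← upRel_star, star_hook]
  exact upRel_hook hi

theorem hook_strand (hi : i + 1 < n) {k : Fin n} (hk : (k : ℕ) ≠ i ∧ (k : ℕ) ≠ i + 1) :
    (hook i hi).1.rel (Sum.inl k) (Sum.inr k) := by
  change arcs (hookPath n i) k (2 * n - 1 - k)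
  refine ⟨?_, fun z hz => ?_⟩
  · simp only [level, hookPath]
    split_ifs <;> omega
  · simp only [level, hookPath]
    split_ifs <;> omega

end Hook

section HookMul
variable (hi : i + 1 < n) (β : JonesMonoid n) {x y : Fin n ⊕ Fin n}

theorem stack_hook_lower (hx : circ x ≠ i ∧ circ x ≠ i + 1) :
    stack (hook i hi).1.rel β.1.rel (outer x) (lower x) := by
  rcases x with k | k
  · exact stack_upper (hook_strand hi hx)
  · exact Setoid.refl' _ _

theorem hook_mul_rel (hx : circ x ≠ i ∧ circ x ≠ i + 1) (hy : circ y ≠ i ∧ circ y ≠ i + 1)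
    (hxy : β.1.rel x y) : (hook i hi * β).1.rel x y :=
  let s := stack (hook i hi).1.rel β.1.rel
  s.trans' (stack_hook_lower hi β hx)
    (s.trans' (stack_lower hxy) (s.symm' (stack_hook_lower hi β hy)))

theorem hook_mul_rel_of_lower (hx : circ x ≠ i ∧ circ x ≠ i + 1)
    (hy : circ y ≠ i ∧ circ y ≠ i + 1) {b c : Fin n}
    (hbc : loRel (hook i hi) b c) (hxb : β.1.rel x (Sum.inl b)) (hcy : β.1.rel (Sum.inl c) y) :
    (hook i hi * β).1.rel x y :=
  let s := stack (hook i hi).1.rel β.1.rel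
  s.trans' (stack_hook_lower hi β hx)
    (s.trans' (stack_lower hxb) (s.trans' (stack_upper (x := Sum.inr b) (y := Sum.inr c) hbc)
      (s.trans' (stack_lower hcy) (s.symm' (stack_hook_lower hi β hy)))))

theorem upRel_hook_mul :
    upRel (hook i hi * β) ⟨i, Nat.lt_of_succ_lt hi⟩ ⟨i + 1, hi⟩ :=
  upRel_le_mul _ _ (upRel_hook hi)

theorem hook_mul_rel_of_mem (hx : circ x = i ∨ circ x = i + 1)
    (hy : circ y = i ∨ circ y = i + 1) : (hook i hi * β).1.rel x y := by
  have hends : ∀ z : Fin n ⊕ Fin n, circ z = i ∨ circ z = i + 1 →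
      (hook i hi * β).1.rel (Sum.inl ⟨i, Nat.lt_of_succ_lt hi⟩) z := by
    rintro z (hz | hz)
    · rw [show z = Sum.inl ⟨i, Nat.lt_of_succ_lt hi⟩ from circ_injective hz]
    · rw [show z = Sum.inl ⟨i + 1, hi⟩ from circ_injective hz]
      exact upRel_hook_mul hi β
  exact Setoid.trans' _ (Setoid.symm' _ (hends x hx)) (hends y hy)

variable {α : JonesMonoid n}

theorem circ_mem_or_notMem_of_upRel (h : upRel α ⟨i, Nat.lt_of_succ_lt hi⟩ ⟨i + 1, hi⟩)
    (hxy : α.1.rel x y) :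
    (circ x ≠ i ∧ circ x ≠ i + 1) ∧ (circ y ≠ i ∧ circ y ≠ i + 1) ∨
      (circ x = i ∨ circ x = i + 1) ∧ (circ y = i ∨ circ y = i + 1) := by
  have hpair := α.2.1.mem_pair_iff h (circ_injective.ne_iff.1 (Nat.succ_ne_self i).symm) hxy
  simp only [← circ_injective.eq_iff, circ, Sum.elim_inl] at hpair ⊢
  tauto

theorem hook_mul_self (h : upRel α ⟨i, Nat.lt_of_succ_lt hi⟩ ⟨i + 1, hi⟩) :
    hook i hi * α = α := by
  refine (eq_of_le fun x y hxy => ?_).symm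
  rcases circ_mem_or_notMem_of_upRel hi h hxy with ⟨hx, hy⟩ | ⟨hx, hy⟩
  · exact hook_mul_rel hi α hx hy hxy
  · exact hook_mul_rel_of_mem hi α hx hy

theorem hook_succ_mul_hook_mul_rel (hi' : i + 1 + 1 < n)
    (h : upRel α ⟨i + 1, hi⟩ ⟨i + 1 + 1, hi'⟩) (hy : circ y ≠ i + 1 ∧ circ y ≠ i + 1 + 1)
    (hyi : circ y ≠ i) (hxy : α.1.rel (Sum.inl ⟨i, Nat.lt_of_succ_lt hi⟩) y) :
    (hook (i + 1) hi' * (hook i hi * α)).1.rel (Sum.inl ⟨i, Nat.lt_of_succ_lt hi⟩) y := by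
  have hinner : (hook i hi * α).1.rel (Sum.inl ⟨i + 1 + 1, hi'⟩) y :=
    hook_mul_rel_of_lower hi α (by simp only [circ, Sum.elim_inl]; omega) ⟨hyi, hy.1⟩
      (Setoid.symm' _ (loRel_hook hi)) (α.1.rel.symm' h) hxy
  exact hook_mul_rel_of_lower hi' _ (by simp only [circ, Sum.elim_inl]; omega) hy
    (loRel_hook hi') (upRel_hook_mul hi α) hinner

theorem hook_succ_mul_hook_mul (hi' : i + 1 + 1 < n)
    (h : upRel α ⟨i + 1, hi⟩ ⟨i + 1 + 1, hi'⟩) :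
    hook (i + 1) hi' * (hook i hi * α) = α := by
  refine (eq_of_le fun x y hxy => ?_).symm
  rcases circ_mem_or_notMem_of_upRel hi' h hxy with ⟨hx, hy⟩ | ⟨hx, hy⟩
  · rcases eq_or_ne (circ x) i with hxi | hxi <;> rcases eq_or_ne (circ y) i with hyi | hyi
    · rw [circ_injective (hxi.trans hyi.symm)]
    · obtain rfl : x = Sum.inl ⟨i, Nat.lt_of_succ_lt hi⟩ := circ_injective hxi
      exact hook_succ_mul_hook_mul_rel hi hi' h hy hyi hxy
    · obtain rfl : y = Sum.inl ⟨i, Nat.lt_of_succ_lt hi⟩ := circ_injective hyi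
      exact Setoid.symm' _ (hook_succ_mul_hook_mul_rel hi hi' h hx hxi (α.1.rel.symm' hxy))
    · exact hook_mul_rel hi' _ hx hy (hook_mul_rel hi α ⟨hxi, hx.1⟩ ⟨hyi, hy.1⟩ hxy)
  · exact hook_mul_rel_of_mem hi' _ hx hy

theorem rank_le_rank_hook_mul (α : JonesMonoid n) : α.1.rank ≤ (hook i hi * α).1.rank + 2 := by
  let partners : Fin n → Set (Fin n) := fun k => {j | α.1.rel (Sum.inl k) (Sum.inr j)}
  have hpartners : ∀ k, (partners k).ncard ≤ 1 := fun k =>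
    (Set.ncard_le_one_iff (Set.toFinite _)).2 fun ha hb =>
      Sum.inr_injective (α.2.1.eq_of_rel ha hb Sum.inr_ne_inl Sum.inr_ne_inl)
  have hsub : through (star α) ⊆ through (star (hook i hi * α)) ∪
      (partners ⟨i, Nat.lt_of_succ_lt hi⟩ ∪ partners ⟨i + 1, hi⟩) := by
    rintro j ⟨k, hjk⟩
    have hkj : α.1.rel (Sum.inl k) (Sum.inr j) := α.1.rel.symm' hjk
    by_cases hk : (k : ℕ) = i
    · obtain rfl : k = ⟨i, Nat.lt_of_succ_lt hi⟩ := Fin.ext hk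
      exact Or.inr (Or.inl hkj)
    by_cases hk' : (k : ℕ) = i + 1
    · obtain rfl : k = ⟨i + 1, hi⟩ := Fin.ext hk'
      exact Or.inr (Or.inr hkj)
    · have hj : circ (Sum.inr j : Fin n ⊕ Fin n) = 2 * n - 1 - j := rfl
      exact Or.inl ⟨k, hook_mul_rel hi α (x := Sum.inr j) (by omega) ⟨hk, hk'⟩ hjk⟩
  rw [← rank_star α, ← rank_star (hook i hi * α), rank_eq_ncard_through, rank_eq_ncard_through]
  calc (through (star α)).ncard
      ≤ _ := Set.ncard_le_ncard hsub (Set.toFinite _)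
    _ ≤ _ := Set.ncard_union_le _ _
    _ ≤ _ := Nat.add_le_add_left ((Set.ncard_union_le _ _).trans
        (Nat.add_le_add (hpartners _) (hpartners _))) _

end HookMul

section Generation
variable {α : JonesMonoid n}

theorem height_of_upRel (hi : i + 1 < n)
    (h : upRel α ⟨i, Nat.lt_of_succ_lt hi⟩ ⟨i + 1, hi⟩) :
    height α.1.rel (i + 1) = height α.1.rel i + 1 ∧
      height α.1.rel (i + 2) = height α.1.rel i := by
  have hup : height α.1.rel (i + 1) = height α.1.rel i + 1 :=
    height_succ_of_lt α.2.1 (x := Sum.inl ⟨i, Nat.lt_of_succ_lt hi⟩) (y := Sum.inl ⟨i + 1, hi⟩)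
      i.lt_succ_self h
  have hdown : height α.1.rel (i + 1) = height α.1.rel (i + 2) + 1 :=
    height_of_gt α.2.1 (x := Sum.inl ⟨i + 1, hi⟩) (y := Sum.inl ⟨i, Nat.lt_of_succ_lt hi⟩)
      i.lt_succ_self (α.1.rel.symm' h)
  omega

theorem exists_upRel_succ (h : α.1.rank < n) :
    ∃ (i : ℕ) (hi : i + 1 < n), upRel α ⟨i, Nat.lt_of_succ_lt hi⟩ ⟨i + 1, hi⟩ := by
  classical
  have hex : ∃ m ≤ n, height α.1.rel m ≠ m := ⟨n, le_rfl, by rw [height_mid]; exact h.ne⟩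
  obtain ⟨hm, hne⟩ := Nat.find_spec hex
  have hmin : ∀ j < Nat.find hex, height α.1.rel j = j := fun j hj => by
    have := Nat.find_min hex hj
    push Not at this
    exact this (hj.le.trans hm)
  generalize Nat.find hex = m at *
  have hzero := height_zero α.1.rel
  obtain ⟨j, rfl⟩ : ∃ j, m = j + 1 := Nat.exists_eq_succ_of_ne_zero (by rintro rfl; omega)
  have hj := hmin j j.lt_succ_self
  have hdown := (unitSteps_height α.2.1 j (by omega)).resolve_left (by omega)
  obtain ⟨i, rfl⟩ : ∃ i, j = i + 1 := Nat.exists_eq_succ_of_ne_zero (by rintro rfl; omega)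
  have hi := hmin i (by omega)
  have hup : height α.1.rel (i + 1) = height α.1.rel i + 1 := by omega
  have harc : arcs (height α.1.rel) i (i + 1) := by
    refine ⟨?_, fun z hz => ?_⟩
    · rw [level_eq_left hup, level_eq_right hdown]
      omega
    · obtain rfl : z = i + 1 := by omega
      rw [level_eq_left hup]
      omega
  refine ⟨i, by omega, ?_⟩
  change α.1.rel (Sum.inl _) (Sum.inl _)
  rw [← ofPath_height α.2.1 α.2.2]
  exact harc

/-- The submonoid generated by the hooks. -/
def hookMonoid (n : ℕ) : Submonoid (JonesMonoid n) :=
  Submonoid.closure {α | ∃ (i : ℕ) (hi : i + 1 < n), α = hook i hi}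

theorem hook_mem_hookMonoid (hi : i + 1 < n) : hook i hi ∈ hookMonoid n :=
  Submonoid.subset_closure ⟨i, hi, rfl⟩

theorem star_mem_hookMonoid (h : α ∈ hookMonoid n) : star α ∈ hookMonoid n := by
  induction h using Submonoid.closure_induction with
  | mem _ hmem =>
    obtain ⟨i, hi, rfl⟩ := hmem
    rw [star_hook]
    exact hook_mem_hookMonoid hi
  | one => rw [star_one]; exact one_mem _
  | mul β γ _ _ hβ hγ => rw [star_mul]; exact mul_mem hγ hβ

theorem exists_hookMonoid_mul_eq (hn : 0 + 1 < n) (h : α.1.rank < n) :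
    ∃ ε ∈ hookMonoid n, ∃ β : JonesMonoid n, β.1.rank = α.1.rank ∧ loRel β = loRel α ∧
      upRel β ⟨0, Nat.lt_of_succ_lt hn⟩ ⟨0 + 1, hn⟩ ∧ ε * β = α := by
  obtain ⟨i, hi, hup⟩ := exists_upRel_succ h
  clear h
  induction i generalizing α with
  | zero => exact ⟨1, one_mem _, α, rfl, rfl, hup, one_mul α⟩
  | succ i ih =>
    have hi' : i + 1 < n := Nat.lt_of_succ_lt hi
    have hα := hook_succ_mul_hook_mul hi' hi hup
    have hrank : (hook i hi' * α).1.rank = α.1.rank := by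
      refine le_antisymm (rank_mul_le_right _ _) ?_
      conv_lhs => rw [← hα]
      exact rank_mul_le_right _ _
    obtain ⟨ε, hε, β, hβrank, hβlo, hβup, hβ⟩ := ih hi' (upRel_hook_mul hi' α)
    refine ⟨hook (i + 1) hi * ε, mul_mem (hook_mem_hookMonoid hi) hε, β, hβrank.trans hrank,
      hβlo.trans (loRel_mul_of_rank_eq hrank), hβup, ?_⟩
    rw [mul_assoc, hβ, hα]

/-- The path obtained by lifting `h` by `2` between the outermost two steps on either side. -/
def raise (n : ℕ) (h : ℕ → ℕ) (j : ℕ) : ℕ := if 2 ≤ j ∧ j ≤ 2 * n - 2 then h j + 2 else h j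

section Raise
variable {h : ℕ → ℕ}

theorem unitSteps_raise (hs : UnitSteps (2 * n) h) (h1 : h 1 = 1) (h2 : h 2 = 0)
    (hN2 : h (2 * n - 2) = 0) (hN1 : h (2 * n - 1) = 1) :
    UnitSteps (2 * n) (raise n h) := by
  intro j hj
  have hstep := hs j hj
  unfold raise
  rcases eq_or_ne j 1 with rfl | hj1
  · rw [one_add_one_eq_two] at hstep ⊢
    split_ifs <;> omega
  rcases eq_or_ne j (2 * n - 2) with rfl | hj2
  · rw [show 2 * n - 2 + 1 = 2 * n - 1 by omega] at hstep ⊢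
    split_ifs <;> omega
  · split_ifs <;> omega

theorem arcs_raise {a b : ℕ} (hab : arcs h a b) (ha : 2 ≤ a ∧ a < 2 * n - 2)
    (hb : 2 ≤ b ∧ b < 2 * n - 2) : arcs (raise n h) a b := by
  have hraise : ∀ j, 2 ≤ j → j ≤ 2 * n - 2 → raise n h j = h j + 2 := fun j hj hj' =>
    if_pos ⟨hj, hj'⟩
  have hlevel : ∀ j, 2 ≤ j → j < 2 * n - 2 → level (raise n h) j = level h j + 2 := by
    intro j hj hj'
    rw [level, level, hraise j hj hj'.le, hraise (j + 1) (by omega) hj', Nat.add_min_add_right]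
  refine ⟨by rw [hlevel a ha.1 ha.2, hlevel b hb.1 hb.2, hab.1], fun z hz => ?_⟩
  rw [hlevel a ha.1 ha.2, hraise z (by omega) (by omega)]
  exact Nat.add_lt_add_right (hab.2 z hz) 2

theorem arcs_raise_strand (hn : 1 < n) (h0 : h 0 = 0) (h1 : h 1 = 1) (hN1 : h (2 * n - 1) = 1)
    (hN : h (2 * n) = 0) {a : ℕ} (ha : a < 2) : arcs (raise n h) a (2 * n - 1 - a) := by
  have hends : raise n h 0 = 0 ∧ raise n h 1 = 1 ∧
      raise n h (2 * n - 1) = 1 ∧ raise n h (2 * n) = 0 :=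
    ⟨(if_neg (by omega)).trans h0, (if_neg (by omega)).trans h1, (if_neg (by omega)).trans hN1,
      (if_neg (by omega)).trans hN⟩
  have hinner : ∀ j, 2 ≤ j → j ≤ 2 * n - 2 → 2 ≤ raise n h j := fun j hj hj' => by
    rw [raise, if_pos ⟨hj, hj'⟩]
    exact Nat.le_add_left _ _
  have h2 := hinner 2 le_rfl (by omega)
  have hN2 := hinner (2 * n - 2) (by omega) le_rfl
  have hleft : level (raise n h) a = a := by
    interval_cases a <;> simp only [level, zero_add, Nat.reduceAdd] <;> omega
  have hright : level (raise n h) (2 * n - 1 - a) = a := by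
    interval_cases a
    · rw [level, show 2 * n - 1 - 0 = 2 * n - 1 by omega, show 2 * n - 1 + 1 = 2 * n by omega]
      omega
    · rw [level, show 2 * n - 1 - 1 = 2 * n - 2 by omega,
        show 2 * n - 2 + 1 = 2 * n - 1 by omega]
      omega
  refine ⟨hleft.trans hright.symm, fun z hz => ?_⟩
  rw [hleft]
  rcases eq_or_ne z 1 with rfl | hz1
  · omega
  rcases eq_or_ne z (2 * n - 1) with rfl | hz2
  · omega
  · have := hinner z (by omega) (by omega)
    omega

end Raise

theorem height_of_upRel_of_loRel (hn : 0 + 1 < n)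
    (hup : upRel α ⟨0, Nat.lt_of_succ_lt hn⟩ ⟨0 + 1, hn⟩)
    (hlo : loRel α ⟨0, Nat.lt_of_succ_lt hn⟩ ⟨0 + 1, hn⟩) :
    height α.1.rel 1 = 1 ∧ height α.1.rel 2 = 0 ∧
      height α.1.rel (2 * n - 2) = 0 ∧ height α.1.rel (2 * n - 1) = 1 := by
  obtain ⟨hup1, hup2⟩ := height_of_upRel hn hup
  obtain ⟨hlo1, hlo2⟩ := height_of_upRel (α := star α) hn hlo
  rw [height_zero, zero_add] at hup1 hup2 hlo1 hlo2
  rw [height_star _ (by omega)] at hlo1 hlo2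
  exact ⟨hup1, hup2, hlo2, hlo1⟩

theorem loRel_hook_zero (hn : 0 + 1 < n) {j k : Fin n} (hj : (j : ℕ) < 2) (hk : (k : ℕ) < 2) :
    loRel (hook 0 hn) j k := by
  have hzero : ∀ l : Fin n, (l : ℕ) < 2 → loRel (hook 0 hn) ⟨0, Nat.lt_of_succ_lt hn⟩ l := by
    rintro ⟨l, _⟩ hl
    change l < 2 at hl
    interval_cases l
    · exact Setoid.refl' _ _
    · exact loRel_hook hn
  exact Setoid.trans' _ (Setoid.symm' _ (hzero j hj)) (hzero k hk)

theorem rel_hook_mul_of_arcs_raise (hn : 0 + 1 < n)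
    (hup : upRel α ⟨0, Nat.lt_of_succ_lt hn⟩ ⟨0 + 1, hn⟩)
    (hlo : loRel α ⟨0, Nat.lt_of_succ_lt hn⟩ ⟨0 + 1, hn⟩) {β : JonesMonoid n}
    (hβ : ∀ x y, arcs (raise n (height α.1.rel)) (circ x) (circ y) → β.1.rel x y)
    {x y : Fin n ⊕ Fin n} (hxy : α.1.rel x y) : (hook 0 hn * β).1.rel x y := by
  obtain ⟨h1, h2, hN2, hN1⟩ := height_of_upRel_of_loRel hn hup hlo
  have hx := circ_lt x
  have hy := circ_lt y
  rcases circ_mem_or_notMem_of_upRel hn hup hxy with ⟨hxu, hyu⟩ | ⟨hxu, hyu⟩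
  swap
  · exact hook_mul_rel_of_mem hn β hxu hyu
  have hpair := α.2.1.mem_pair_iff hlo (Sum.inr_injective.ne (Fin.ne_of_val_ne zero_ne_one)) hxy
  simp only [← circ_injective.eq_iff] at hpair
  change (circ x = 2 * n - 1 - 0 ∨ circ x = 2 * n - 1 - (0 + 1)) ↔
    (circ y = 2 * n - 1 - 0 ∨ circ y = 2 * n - 1 - (0 + 1)) at hpair
  by_cases hxl : circ x < 2 * n - 2
  · rw [← ofPath_height α.2.1 α.2.2] at hxy
    exact hook_mul_rel hn β hxu hyu (hβ x y (arcs_raise hxy (by omega) (by omega)))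
  · have hlower : ∀ z : Fin n ⊕ Fin n, (circ z ≠ 0 ∧ circ z ≠ 0 + 1) → 2 * n - 2 ≤ circ z →
        ∃ k : Fin n, (k : ℕ) < 2 ∧ β.1.rel z (Sum.inl k) := by
      intro z hzu hz
      have hz' := circ_lt z
      have hk : 2 * n - 1 - circ z < n := by omega
      refine ⟨⟨2 * n - 1 - circ z, hk⟩, by change 2 * n - 1 - circ z < 2; omega, ?_⟩
      have hstrand := arcs_raise_strand hn (height_zero _) h1 hN1 (height_last _)
        (a := 2 * n - 1 - circ z) (by omega)
      rw [Nat.sub_sub_self (by omega)] at hstrand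
      exact β.1.rel.symm' (hβ (Sum.inl ⟨2 * n - 1 - circ z, hk⟩) z hstrand)
    obtain ⟨j, hj, hxj⟩ := hlower x hxu (by omega)
    obtain ⟨k, hk, hyk⟩ := hlower y hyu (by omega)
    exact hook_mul_rel_of_lower hn β hxu hyu (loRel_hook_zero hn hj hk) hxj (β.1.rel.symm' hyk)

theorem exists_hook_mul_eq (hn : 0 + 1 < n)
    (hup : upRel α ⟨0, Nat.lt_of_succ_lt hn⟩ ⟨0 + 1, hn⟩)
    (hlo : loRel α ⟨0, Nat.lt_of_succ_lt hn⟩ ⟨0 + 1, hn⟩) :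
    ∃ β : JonesMonoid n, α.1.rank < β.1.rank ∧ hook 0 hn * β = α := by
  obtain ⟨h1, h2, hN2, hN1⟩ := height_of_upRel_of_loRel hn hup hlo
  have hs := unitSteps_raise (unitSteps_height α.2.1) h1 h2 hN2 hN1
  have h0 : raise n (height α.1.rel) 0 = 0 := (if_neg (by omega)).trans (height_zero _)
  have hN : raise n (height α.1.rel) (2 * n) = 0 := (if_neg (by omega)).trans (height_last _)
  let β : JonesMonoid n := ofPath hs h0 hN
  have hrank : β.1.rank = α.1.rank + 2 := by
    rw [← height_mid β, ← height_mid α]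
    exact (height_ofPath hs h0 hN (by omega)).trans (if_pos (by omega))
  refine ⟨β, by omega, (eq_of_le fun x y hxy => ?_).symm⟩
  exact rel_hook_mul_of_arcs_raise hn hup hlo (fun _ _ h => h) hxy

theorem upRel_eq_bot (h : α.1.rank = n) : upRel α = ⊥ := by
  have hthrough : through α = Set.univ := by
    refine Set.eq_of_subset_of_ncard_le (Set.subset_univ _) ?_
    rw [← rank_eq_ncard_through, Set.ncard_univ, Nat.card_eq_fintype_card, Fintype.card_fin, h]
  refine eq_bot_iff.2 fun x y hxy => ?_
  exact (mem_through_iff.1 (hthrough ▸ Set.mem_univ x) y hxy).symm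

theorem eq_one_of_rank_eq (h : α.1.rank = n) : α = 1 := by
  refine ext_upRel_loRel ?_ ?_
  · rw [upRel_eq_bot h, upRel_eq_bot rank_one]
  · rw [← upRel_star, ← upRel_star, upRel_eq_bot ((rank_star α).trans h), star_one,
      upRel_eq_bot rank_one]

theorem hookMonoid_eq_top : hookMonoid n = ⊤ := by
  refine eq_top_iff.2 fun α _ => ?_
  induction hd : n - α.1.rank using Nat.strong_induction_on generalizing α with
  | _ d ih =>
    rcases (rank_le α).eq_or_lt with heq | hlt
    · rw [eq_one_of_rank_eq heq]
      exact one_mem _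
    · obtain ⟨i, hi, -⟩ := exists_upRel_succ hlt
      have hn : 0 + 1 < n := by omega
      obtain ⟨ε, hε, β, hβ, -, hβup, rfl⟩ := exists_hookMonoid_mul_eq hn hlt
      obtain ⟨ε', hε', γ, hγ, hγlo, hγup, hγβ⟩ :=
        exists_hookMonoid_mul_eq (α := star β) hn (by rw [rank_star]; omega)
      have hγlo' : loRel γ = upRel β := hγlo
      obtain ⟨δ, hδ, hγδ⟩ := exists_hook_mul_eq hn hγup (hγlo' ▸ hβup)
      have hγrank : γ.1.rank = (ε * β).1.rank := hγ.trans ((rank_star β).trans hβ)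
      have hδmem : δ ∈ hookMonoid n := ih (n - δ.1.rank) (by omega) δ trivial rfl
      have hβmem : star β ∈ hookMonoid n := by
        rw [← hγβ, ← hγδ]
        exact mul_mem hε' (mul_mem (hook_mem_hookMonoid hn) hδmem)
      exact mul_mem hε (star_star β ▸ star_mem_hookMonoid hβmem)

end Generation
end JonesMonoid

namespace JonesMonoid
open Diagram
variable {n r : ℕ}

theorem rank_mod_two (α : JonesMonoid n) : α.1.rank % 2 = n % 2 := by
  have hheight : ∀ i ≤ n, height α.1.rel i % 2 = i % 2 := by
    intro i hi
    induction i with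
    | zero => rw [height_zero]
    | succ i ih =>
      have := ih (by omega)
      have := unitSteps_height α.2.1 i (by omega)
      omega
  rw [← height_mid]
  exact hheight n le_rfl

theorem exists_rank_add_two_mul_eq (α : JonesMonoid n) : ∃ k, α.1.rank + 2 * k = n := by
  have hle := rank_le α
  have hmod := rank_mod_two α
  exact ⟨(n - α.1.rank) / 2, by omega⟩

theorem hook_induction {P : JonesMonoid n → Prop} (one : P 1)
    (hook_mul : ∀ (i : ℕ) (hi : i + 1 < n) (α : JonesMonoid n), P α → P (hook i hi * α))
    (α : JonesMonoid n) : P α := by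
  have hα : α ∈ hookMonoid n := hookMonoid_eq_top ▸ Submonoid.mem_top α
  induction hα using Submonoid.closure_induction_left with
  | one => exact one
  | mul_left _ hmem α _ ih =>
    obtain ⟨i, hi, rfl⟩ := hmem
    exact hook_mul i hi α ih

theorem exists_eq_mul_rank_mul_eq_left {β : JonesMonoid n} (hβ : r ≤ β.1.rank)
    (hr : r % 2 = n % 2) {α : JonesMonoid n} (hα : (α * β).1.rank ≤ r) :
    ∃ γ γ' : JonesMonoid n, α = γ * γ' ∧ (γ' * β).1.rank = r := by
  induction α using hook_induction with
  | one =>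
    rw [one_mul] at hα
    exact ⟨1, 1, (mul_one 1).symm, by rw [one_mul]; exact le_antisymm hα hβ⟩
  | hook_mul i hi α ih =>
    rcases Nat.lt_or_ge r (α * β).1.rank with hlt | hge
    · refine ⟨1, hook i hi * α, (one_mul _).symm, ?_⟩
      have hdrop := rank_le_rank_hook_mul hi (α * β)
      have hparity := rank_mod_two (α * β)
      rw [mul_assoc] at hα ⊢
      have hparity' := rank_mod_two (hook i hi * (α * β))
      omega
    · obtain ⟨γ, γ', rfl, hγ'⟩ := ih hge
      exact ⟨hook i hi * γ, γ', (mul_assoc _ _ _).symm, hγ'⟩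

theorem exists_eq_mul_rank_mul_eq_right {β : JonesMonoid n} (hβ : r ≤ β.1.rank)
    (hr : r % 2 = n % 2) {α : JonesMonoid n} (hα : (β * α).1.rank ≤ r) :
    ∃ γ γ' : JonesMonoid n, α = γ * γ' ∧ (β * γ).1.rank = r := by
  obtain ⟨γ, γ', hfactor, hrank⟩ := exists_eq_mul_rank_mul_eq_left (β := star β) (α := star α)
    (by rwa [rank_star]) hr (by rwa [← star_mul, rank_star])
  refine ⟨star γ', star γ, ?_, ?_⟩
  · rw [← star_mul, ← hfactor, star_star]
  · rw [← rank_star, star_mul, star_star, hrank]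

/-- The projections of rank `r`, which turn out to form a least generating set of `I_r`. -/
def projections (n r : ℕ) : Set (JonesMonoid n) := {α | α.1.rank = r ∧ IsStarProjection α}

theorem isStarProjection_mul_star_self (α : JonesMonoid n) : IsStarProjection (α * star α) where
  isIdempotentElem := by rw [IsIdempotentElem, ← mul_assoc, mul_star_self_mul]
  isSelfAdjoint := IsSelfAdjoint.mul_star_self α

theorem mul_star_self_mem_projections {α : JonesMonoid n} (hα : α.1.rank = r) :
    α * star α ∈ projections n r :=
  ⟨(rank_mul_star_self α).trans hα, isStarProjection_mul_star_self α⟩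

theorem isStarProjection_hook {i : ℕ} (hi : i + 1 < n) : IsStarProjection (hook i hi) where
  isIdempotentElem := hook_mul_self hi (upRel_hook hi)
  isSelfAdjoint := star_hook hi

theorem ncard_projections (n r : ℕ) : (projections n r).ncard = (ballotPaths n r).ncard := by
  refine Set.ncard_congr (fun α _ => upPath α) ?_ ?_ ?_
  · rintro α ⟨rfl, -⟩
    exact upPath_mem_ballotPaths α
  · rintro α β ⟨-, hα⟩ ⟨-, hβ⟩ hpath
    have hup : upRel α = upRel β := upPath_eq_iff.1 hpath
    refine ext_upRel_loRel hup ?_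
    rw [← upRel_star, ← upRel_star, hα.isSelfAdjoint.star_eq, hβ.isSelfAdjoint.star_eq, hup]
  · intro p hp
    obtain ⟨α, hα, rfl, -⟩ := exists_upPath_eq hp hp
    exact ⟨α * star α, mul_star_self_mem_projections hα,
      upPath_eq_iff.2 (upRel_mul_of_rank_eq (rank_mul_star_self α))⟩

section Generation

/-- The subsemigroup generated by the projections of rank `r`. -/
def projectionClosure (n r : ℕ) : Subsemigroup (JonesMonoid n) :=
  Subsemigroup.closure (projections n r)

theorem mul_star_self_mem_projectionClosure {α : JonesMonoid n} (hα : α.1.rank = r) :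
    α * star α ∈ projectionClosure n r :=
  Subsemigroup.subset_closure (mul_star_self_mem_projections hα)

theorem mul_star_self_mul_mul_star_self_mul {ε : JonesMonoid n} (hε : IsStarProjection ε)
    (α : JonesMonoid n) : (ε * α) * star (ε * α) * (α * star α) * α = ε * α := by
  have hεα : (ε * α) * star (ε * α) * α = (ε * α) * star (ε * α) * (ε * α) := by
    rw [star_mul, hε.isSelfAdjoint.star_eq]
    simp only [mul_assoc]
    rw [← mul_assoc ε ε α, hε.isIdempotentElem.eq]
  rw [mul_assoc, mul_star_self_mul, hεα, mul_star_self_mul]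

theorem mul_mem_projectionClosure_of_rank_eq {α β : JonesMonoid n}
    (hβ : β ∈ projectionClosure n r) (hβr : β.1.rank = r) (hαβ : (α * β).1.rank = r) :
    α * β ∈ projectionClosure n r := by
  induction α using hook_induction with
  | one => rwa [one_mul]
  | hook_mul i hi α ih =>
    rw [mul_assoc] at hαβ ⊢
    have hrank : (α * β).1.rank = r := le_antisymm ((rank_mul_le_right _ _).trans hβr.le)
      (hαβ.symm.le.trans (rank_mul_le_right _ _))
    rw [← mul_star_self_mul_mul_star_self_mul (isStarProjection_hook hi)]
    exact mul_mem (mul_mem (mul_star_self_mem_projectionClosure hαβ)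
      (mul_star_self_mem_projectionClosure hrank)) (ih hrank)

theorem mem_projectionClosure_of_rank_eq {α : JonesMonoid n} (hα : α.1.rank = r) :
    α ∈ projectionClosure n r := by
  have hstar : star α * star (star α) ∈ projections n r :=
    mul_star_self_mem_projections ((rank_star α).trans hα)
  rw [star_star] at hstar
  have hmul : α * (star α * α) = α := by rw [← mul_assoc, mul_star_self_mul]
  rw [← hmul]
  exact mul_mem_projectionClosure_of_rank_eq (Subsemigroup.subset_closure hstar) hstar.1
    (by rw [hmul, hα])

theorem hook_mul_mem_projectionClosure (hr : r + 2 ≤ n) {i : ℕ} (hi : i + 1 < n)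
    {α : JonesMonoid n} (hα : α.1.rank = r) : hook i hi * α ∈ projectionClosure n r := by
  have hhook : r ≤ (hook i hi).1.rank := by
    have := rank_le_rank_hook_mul hi 1
    rw [mul_one, rank_one] at this
    omega
  have hle : (hook i hi * (α * star α)).1.rank ≤ r :=
    (rank_mul_le_right _ _).trans ((rank_mul_star_self α).trans hα).le
  obtain ⟨β, γ, hβγ, hβ⟩ := exists_eq_mul_rank_mul_eq_right hhook (hα ▸ rank_mod_two α) hle
  have hmul : β * (γ * α) = α := by rw [← mul_assoc, ← hβγ, mul_star_self_mul]
  have hγ : (γ * α).1.rank = r := by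
    refine le_antisymm ((rank_mul_le_right _ _).trans hα.le) ?_
    rw [← hα]
    conv_lhs => rw [← hmul]
    exact rank_mul_le_right _ _
  rw [← hmul, ← mul_assoc]
  exact mul_mem (mem_projectionClosure_of_rank_eq hβ) (mem_projectionClosure_of_rank_eq hγ)

theorem mul_mem_projectionClosure (hr : r + 2 ≤ n) (α : JonesMonoid n) {β : JonesMonoid n}
    (hβ : β ∈ projectionClosure n r) : α * β ∈ projectionClosure n r := by
  induction α using hook_induction with
  | one => rwa [one_mul]
  | hook_mul i hi α ih =>
    rw [mul_assoc]
    generalize α * β = γ at ih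
    induction ih using Subsemigroup.closure_induction with
    | mem _ hmem => exact hook_mul_mem_projectionClosure hr hi hmem.1
    | mul _ _ _ hγ' hγ _ =>
      rw [← mul_assoc]
      exact mul_mem hγ hγ'

theorem coe_projectionClosure (hr : r + 2 ≤ n) (hparity : r % 2 = n % 2) :
    (projectionClosure n r : Set (JonesMonoid n)) = jonesIdeal n r := by
  ext α
  constructor
  · intro hα
    induction hα using Subsemigroup.closure_induction with
    | mem _ hmem => exact hmem.1.le
    | mul α β _ _ hα _ => exact (rank_mul_le_left α β).trans hα
  · intro hα
    obtain ⟨β, γ, rfl, hγ⟩ := exists_eq_mul_rank_mul_eq_left (r := r) (α := α) (β := 1)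
      (by rw [rank_one]; omega) hparity (by rw [mul_one]; exact hα)
    rw [mul_one] at hγ
    exact mul_mem_projectionClosure hr β (mem_projectionClosure_of_rank_eq hγ)

end Generation

theorem exists_upRel_eq_of_mem_closure {A : Set (JonesMonoid n)} {α : JonesMonoid n}
    (hα : α ∈ Subsemigroup.closure A) :
    ∃ β ∈ A, α.1.rank ≤ β.1.rank ∧ (α.1.rank = β.1.rank → upRel α = upRel β) := by
  induction hα using Subsemigroup.closure_induction with
  | mem α hmem => exact ⟨α, hmem, le_rfl, fun _ => rfl⟩
  | mul α γ _ _ hα _ =>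
    obtain ⟨β, hβ, hle, hup⟩ := hα
    have hleft := rank_mul_le_left α γ
    refine ⟨β, hβ, hleft.trans hle, fun heq => ?_⟩
    rw [upRel_mul_of_rank_eq (by omega), hup (by omega)]

theorem ncard_ballotPaths_le_card_of_closure_eq {A : Finset (JonesMonoid n)}
    (hA : (Subsemigroup.closure (A : Set (JonesMonoid n)) : Set (JonesMonoid n)) =
      jonesIdeal n r) : (ballotPaths n r).ncard ≤ A.card := by
  have hsub : ballotPaths n r ⊆ upPath '' (A : Set (JonesMonoid n)) := by
    intro p hp
    obtain ⟨α, hα, rfl, -⟩ := exists_upPath_eq hp hp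
    have hmem : α ∈ (Subsemigroup.closure (A : Set (JonesMonoid n)) : Set (JonesMonoid n)) :=
      hA ▸ hα.le
    obtain ⟨β, hβ, hle, hup⟩ := exists_upRel_eq_of_mem_closure hmem
    have hβr : β ∈ jonesIdeal n r := hA ▸ Subsemigroup.subset_closure hβ
    exact ⟨β, hβ, upPath_eq_iff.2 (hup (le_antisymm hle (hα ▸ hβr))).symm⟩
  calc (ballotPaths n r).ncard ≤ (upPath '' (A : Set (JonesMonoid n))).ncard :=
        Set.ncard_le_ncard hsub (A.finite_toSet.image _)
    _ ≤ (A : Set (JonesMonoid n)).ncard := Set.ncard_image_le A.finite_toSet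
    _ = A.card := Set.ncard_coe_finset A

theorem semigroupRank_jonesIdeal (hr : r + 2 ≤ n) (hparity : r % 2 = n % 2) :
    semigroupRank (jonesIdeal n r) = (ballotPaths n r).ncard := by
  have hfin : (projections n r).Finite := Set.toFinite _
  have hgen : (ballotPaths n r).ncard ∈ {m | ∃ A : Finset (JonesMonoid n), A.card = m ∧
      (Subsemigroup.closure (A : Set (JonesMonoid n)) : Set (JonesMonoid n)) =
        jonesIdeal n r} := by
    refine ⟨hfin.toFinset, ?_, ?_⟩
    · rw [← Set.ncard_eq_toFinset_card _ hfin, ncard_projections]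
    · rw [Set.Finite.coe_toFinset]
      exact coe_projectionClosure hr hparity
  refine le_antisymm (Nat.sInf_le hgen) (le_csInf ⟨_, hgen⟩ ?_)
  rintro _ ⟨A, rfl, hA⟩
  exact ncard_ballotPaths_le_card_of_closure_eq hA

end JonesMonoid

theorem exists_mul_mul_eq_self_of_isSemisimpleRing {R : Type*} [Ring R] [IsSemisimpleRing R]
    (x : R) : ∃ y, x * y * x = x := by
  obtain ⟨e, he, hspan⟩ := IsSemisimpleRing.ideal_eq_span_idempotent (Ideal.span {x})
  obtain ⟨a, ha⟩ := Ideal.mem_span_singleton'.1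
    (show x ∈ Ideal.span {e} from hspan ▸ Ideal.mem_span_singleton_self x)
  obtain ⟨y, hy⟩ := Ideal.mem_span_singleton'.1
    (show e ∈ Ideal.span {x} from hspan ▸ Ideal.mem_span_singleton_self e)
  refine ⟨y, ?_⟩
  rw [mul_assoc, hy, ← ha, mul_assoc, he.eq]

namespace TwistedAlgebra
variable {S R : Type*} [Monoid S] [CommRing R] (ψ : Twisting S R) {s t u : Set S}

/-- The linear combinations of the basis elements belonging to a subset of the monoid. -/
noncomputable def spanOf (s : Set S) : Submodule R (TwistedAlgebra ψ) :=
  Submodule.span R (of ψ '' s)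

variable {ψ}

theorem of_mem_spanOf {a : S} (ha : a ∈ s) : of ψ a ∈ spanOf ψ s :=
  Submodule.subset_span ⟨a, ha, rfl⟩

theorem spanOf_le {N : Submodule R (TwistedAlgebra ψ)} :
    spanOf ψ s ≤ N ↔ ∀ a ∈ s, of ψ a ∈ N :=
  Submodule.span_le.trans Set.image_subset_iff

theorem mem_spanOf_univ (x : TwistedAlgebra ψ) : x ∈ spanOf ψ Set.univ := by
  rw [spanOf, Set.image_univ]
  exact (basis ψ).mem_span x

theorem mul_mem_spanOf (h : ∀ a ∈ s, ∀ b ∈ t, a * b ∈ u) {x y : TwistedAlgebra ψ}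
    (hx : x ∈ spanOf ψ s) (hy : y ∈ spanOf ψ t) : x * y ∈ spanOf ψ u := by
  have hxy := Submodule.mul_mem_mul hx hy
  rw [spanOf, spanOf, Submodule.span_mul_span] at hxy
  refine Submodule.span_le.2 ?_ hxy
  rintro _ ⟨_, ⟨a, ha, rfl⟩, _, ⟨b, hb, rfl⟩, rfl⟩
  rw [SetLike.mem_coe]
  beta_reduce
  rw [of_mul_of]
  exact Submodule.smul_mem _ _ (of_mem_spanOf (h a ha b hb))

theorem smul_eq_zero_of_mem_spanOf {M : Type*} [AddCommGroup M] [Module (TwistedAlgebra ψ) M]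
    {m : M} (h : ∀ a ∈ s, of ψ a • m = 0) {x : TwistedAlgebra ψ} (hx : x ∈ spanOf ψ s) :
    x • m = 0 := by
  have hle : spanOf ψ s ≤
      (LinearMap.ker (LinearMap.toSpanSingleton (TwistedAlgebra ψ) M m)).restrictScalars R :=
    spanOf_le.2 h
  exact hle hx

end TwistedAlgebra

namespace JonesMonoid
open Diagram TwistedAlgebra
variable {n : ℕ} {δ : ℂ} {α β γ : JonesMonoid n}

/-- The `ℒ`-class of a diagram: the diagrams with the same lower half. -/
abbrev LClass (β : JonesMonoid n) : Type := {α : JonesMonoid n // loRel α = loRel β}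

theorem LClass.rank_eq (α : LClass β) : α.1.1.rank = β.1.rank := rank_eq_of_loRel_eq α.2

theorem loRel_mul_eq_iff (γ : JonesMonoid n) (α : LClass β) :
    loRel (γ * α.1) = loRel β ↔ (γ * α.1).1.rank = β.1.rank :=
  ⟨rank_eq_of_loRel_eq, fun h => (loRel_mul_of_rank_eq (h.trans α.rank_eq.symm)).trans α.2⟩

/-- The cell module of the Temperley–Lieb algebra with parameter `δ` belonging to `β`: the linear
span of the `ℒ`-class of `β`, on which products of smaller rank are replaced by zero. -/
def CellModule (_δ : ℂ) (β : JonesMonoid n) : Type := LClass β →₀ ℂ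

noncomputable instance : AddCommGroup (CellModule δ β) :=
  inferInstanceAs (AddCommGroup (LClass β →₀ ℂ))

noncomputable instance : Module ℂ (CellModule δ β) :=
  inferInstanceAs (Module ℂ (LClass β →₀ ℂ))

/-- The basis of a cell module given by the diagrams of the `ℒ`-class. -/
noncomputable def cellBasis (δ : ℂ) (β : JonesMonoid n) :
    Module.Basis (LClass β) ℂ (CellModule δ β) :=
  Module.Basis.ofRepr (LinearEquiv.refl ℂ (LClass β →₀ ℂ))

/-- The linear embedding of a cell module into the algebra. -/
noncomputable def cellIncl : CellModule δ β →ₗ[ℂ] TemperleyLieb n δ :=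
  (cellBasis δ β).constr ℂ fun α => tlBasis δ α.1

open Classical in
/-- The linear projection of the algebra onto a cell module, which kills the diagrams outside the
`ℒ`-class. -/
noncomputable def cellProj : TemperleyLieb n δ →ₗ[ℂ] CellModule δ β :=
  (TwistedAlgebra.basis (jonesTwisting n δ)).constr ℂ fun α =>
    if h : loRel α = loRel β then cellBasis δ β ⟨α, h⟩ else 0

theorem cellIncl_cellBasis (α : LClass β) : cellIncl (cellBasis δ β α) = tlBasis δ α.1 :=
  (cellBasis δ β).constr_basis ℂ _ α

theorem cellProj_tlBasis_of_loRel_eq (h : loRel α = loRel β) :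
    cellProj (tlBasis δ α) = cellBasis δ β ⟨α, h⟩ :=
  ((TwistedAlgebra.basis (jonesTwisting n δ)).constr_basis ℂ _ α).trans (dif_pos h)

theorem cellProj_tlBasis_of_loRel_ne (h : loRel α ≠ loRel β) :
    (cellProj (tlBasis δ α) : CellModule δ β) = 0 :=
  ((TwistedAlgebra.basis (jonesTwisting n δ)).constr_basis ℂ _ α).trans (dif_neg h)

theorem cellProj_cellIncl (v : CellModule δ β) : cellProj (cellIncl v) = v := by
  have h : cellProj ∘ₗ cellIncl = (LinearMap.id : CellModule δ β →ₗ[ℂ] CellModule δ β) :=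
    (cellBasis δ β).ext fun α => by
      rw [LinearMap.comp_apply, cellIncl_cellBasis, cellProj_tlBasis_of_loRel_eq α.2,
        LinearMap.id_apply]
  exact LinearMap.congr_fun h v

theorem cellIncl_mem (v : CellModule δ β) :
    cellIncl v ∈ spanOf (jonesTwisting n δ) {α | loRel α = loRel β} := by
  have h : (⊤ : Submodule ℂ (CellModule δ β)) ≤
      (spanOf (jonesTwisting n δ) {α | loRel α = loRel β}).comap cellIncl := by
    rw [← (cellBasis δ β).span_eq, Submodule.span_le]
    rintro _ ⟨α, rfl⟩
    rw [SetLike.mem_coe, Submodule.mem_comap, cellIncl_cellBasis]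
    exact of_mem_spanOf α.2
  exact h Submodule.mem_top

theorem mul_mem_spanOf_rank_lt {r : ℕ} (a : TemperleyLieb n δ) {x : TemperleyLieb n δ}
    (hx : x ∈ spanOf (jonesTwisting n δ) {α | α.1.rank < r}) :
    a * x ∈ spanOf (jonesTwisting n δ) {α | α.1.rank < r} :=
  mul_mem_spanOf (fun γ _ α hα => (rank_mul_le_right γ α).trans_lt hα) (mem_spanOf_univ a) hx

theorem cellProj_eq_zero {x : TemperleyLieb n δ}
    (hx : x ∈ spanOf (jonesTwisting n δ) {α | α.1.rank < β.1.rank}) :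
    (cellProj x : CellModule δ β) = 0 := by
  have hle : spanOf (jonesTwisting n δ) {α | α.1.rank < β.1.rank} ≤
      LinearMap.ker (cellProj : TemperleyLieb n δ →ₗ[ℂ] CellModule δ β) :=
    spanOf_le.2 fun α hα =>
      cellProj_tlBasis_of_loRel_ne fun h => (ne_of_lt hα) (rank_eq_of_loRel_eq h)
  exact hle hx

theorem cellIncl_cellProj_sub_mem (a : TemperleyLieb n δ) (v : CellModule δ β) :
    cellIncl (cellProj (a * cellIncl v) : CellModule δ β) - a * cellIncl v ∈
      spanOf (jonesTwisting n δ) {α | α.1.rank < β.1.rank} := by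
  set L := spanOf (jonesTwisting n δ) {α | α.1.rank < β.1.rank}
  have hmem : a * cellIncl v ∈
      spanOf (jonesTwisting n δ) {α | loRel α = loRel β ∨ α.1.rank < β.1.rank} := by
    refine mul_mem_spanOf (fun γ _ α hα => ?_) (mem_spanOf_univ a) (cellIncl_mem v)
    have hrank := (rank_mul_le_right γ α).trans_eq (rank_eq_of_loRel_eq hα)
    exact hrank.eq_or_lt.imp_left (loRel_mul_eq_iff γ ⟨α, hα⟩).2
  have hle : spanOf (jonesTwisting n δ) {α | loRel α = loRel β ∨ α.1.rank < β.1.rank} ≤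
      L.comap (cellIncl ∘ₗ (cellProj : _ →ₗ[ℂ] CellModule δ β) - LinearMap.id) := by
    refine spanOf_le.2 fun α hα => ?_
    change cellIncl (cellProj (tlBasis δ α) : CellModule δ β) - tlBasis δ α ∈ L
    by_cases h : loRel α = loRel β
    · rw [cellProj_tlBasis_of_loRel_eq h, cellIncl_cellBasis, sub_self]
      exact zero_mem L
    · rw [cellProj_tlBasis_of_loRel_ne h, map_zero, zero_sub]
      exact neg_mem (of_mem_spanOf (hα.resolve_left h))
  exact hle hmem

noncomputable instance : Module (TemperleyLieb n δ) (CellModule δ β) where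
  smul a v := cellProj (a * cellIncl v)
  one_smul v := by
    change cellProj (1 * cellIncl v) = v
    rw [one_mul, cellProj_cellIncl]
  mul_smul a b v := by
    change cellProj (a * b * cellIncl v) = cellProj (a * cellIncl (cellProj (b * cellIncl v)))
    have h := cellProj_eq_zero (mul_mem_spanOf_rank_lt a (cellIncl_cellProj_sub_mem b v))
    rw [mul_sub, map_sub, sub_eq_zero, ← mul_assoc] at h
    exact h.symm
  smul_zero a := by
    change cellProj (a * cellIncl 0) = 0
    rw [map_zero, mul_zero, map_zero]
  zero_smul v := by
    change cellProj (0 * cellIncl v) = 0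
    rw [zero_mul, map_zero]
  add_smul a b v := by
    change cellProj ((a + b) * cellIncl v) = cellProj (a * cellIncl v) + cellProj (b * cellIncl v)
    rw [add_mul, map_add]
  smul_add a v w := by
    change cellProj (a * cellIncl (v + w)) = cellProj (a * cellIncl v) + cellProj (a * cellIncl w)
    rw [map_add, mul_add, map_add]

theorem smul_eq_cellProj (a : TemperleyLieb n δ) (v : CellModule δ β) :
    a • v = cellProj (a * cellIncl v) := rfl

instance : IsScalarTower ℂ (TemperleyLieb n δ) (CellModule δ β) where
  smul_assoc c a v := by
    rw [smul_eq_cellProj, smul_eq_cellProj, smul_mul_assoc, map_smul]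

theorem tlBasis_smul_of_rank_lt (h : γ.1.rank < β.1.rank) (v : CellModule δ β) :
    tlBasis δ γ • v = 0 := by
  rw [smul_eq_cellProj]
  refine cellProj_eq_zero (mul_mem_spanOf (s := {γ}) ?_ (of_mem_spanOf rfl) (mem_spanOf_univ _))
  rintro _ rfl α _
  exact (rank_mul_le_left _ α).trans_lt h

section Gram

open Classical in
/-- The structure constants of the cell modules: the coefficient of `γα` in the action of `γ` on
`α`. -/
noncomputable def gram (δ : ℂ) (γ α : JonesMonoid n) : ℂ :=
  if (γ * α).1.rank = α.1.rank then (jonesTwisting n δ).toFun γ α else 0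

theorem rank_mul_le_of_loRel_eq {γ γ' : JonesMonoid n} (h : loRel γ = loRel γ')
    (α : JonesMonoid n) : (γ * α).1.rank ≤ (γ' * α).1.rank := by
  rw [← mul_star_mul_of_loRel_eq h, mul_assoc]
  exact rank_mul_le_right _ _

theorem rank_mul_congr {γ γ' α α' : JonesMonoid n} (h : loRel γ = loRel γ')
    (h' : upRel α = upRel α') : (γ * α).1.rank = (γ' * α').1.rank := by
  have hleft : (γ * α).1.rank = (γ' * α).1.rank :=
    (rank_mul_le_of_loRel_eq h α).antisymm (rank_mul_le_of_loRel_eq h.symm α)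
  rw [hleft, ← rank_star, ← rank_star (γ' * α'), star_mul, star_mul]
  have hstar : loRel (star α) = loRel (star α') := h'
  exact (rank_mul_le_of_loRel_eq hstar _).antisymm (rank_mul_le_of_loRel_eq hstar.symm _)

theorem gram_congr {γ γ' α α' : JonesMonoid n} (h : loRel γ = loRel γ')
    (h' : upRel α = upRel α') : gram δ γ α = gram δ γ' α' := by
  have htwist : (jonesTwisting n δ).toFun γ α = (jonesTwisting n δ).toFun γ' α' :=
    congrArg (δ ^ ·) (loops_congr h h')
  rw [gram, gram, rank_mul_congr h h', rank_eq_of_upRel_eq h', htwist]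

theorem tlBasis_smul_cellBasis {κ : LClass β} (hκ : upRel κ.1 = upRel γ) (α : LClass β) :
    tlBasis δ γ • cellBasis δ β α = gram δ γ α.1 • cellBasis δ β κ := by
  have hmul : tlBasis δ γ * tlBasis δ α.1 =
      (jonesTwisting n δ).toFun γ α.1 • tlBasis δ (γ * α.1) := of_mul_of _ _ _
  rw [smul_eq_cellProj, cellIncl_cellBasis, hmul, map_smul, gram]
  split_ifs with h
  · have hlo := (loRel_mul_eq_iff γ α).2 (h.trans α.rank_eq)
    have hup : upRel (γ * α.1) = upRel γ := upRel_mul_of_rank_eq <|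
      h.trans <| α.rank_eq.trans <| κ.rank_eq.symm.trans <| rank_eq_of_upRel_eq hκ
    have hprod : (⟨γ * α.1, hlo⟩ : LClass β) = κ :=
      Subtype.ext (ext_upRel_loRel (hup.trans hκ.symm) (hlo.trans κ.2.symm))
    rw [cellProj_tlBasis_of_loRel_eq hlo, hprod]
  · have hlo : loRel (γ * α.1) ≠ loRel β := fun hlo =>
      h (((loRel_mul_eq_iff γ α).1 hlo).trans α.rank_eq.symm)
    rw [cellProj_tlBasis_of_loRel_ne hlo, smul_zero, zero_smul]

/-- The pairing of the lower half of a diagram with a vector of a cell module. -/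
noncomputable def pairing (γ : JonesMonoid n) : CellModule δ β →ₗ[ℂ] ℂ :=
  (cellBasis δ β).constr ℂ fun α => gram δ γ α.1

theorem pairing_congr {γ γ' : JonesMonoid n} (h : loRel γ = loRel γ') :
    (pairing γ : CellModule δ β →ₗ[ℂ] ℂ) = pairing γ' :=
  congrArg ((cellBasis δ β).constr ℂ) (funext fun _ => gram_congr h rfl)

theorem tlBasis_smul_eq_pairing_smul {κ : LClass β} (hκ : upRel κ.1 = upRel γ)
    (v : CellModule δ β) : tlBasis δ γ • v = pairing γ v • cellBasis δ β κ := by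
  have h : Algebra.lsmul ℂ ℂ (CellModule δ β) (tlBasis δ γ) =
      (pairing γ).smulRight (cellBasis δ β κ) := (cellBasis δ β).ext fun α => by
    rw [Algebra.lsmul_apply, tlBasis_smul_cellBasis hκ, LinearMap.smulRight_apply, pairing,
      Module.Basis.constr_basis]
  exact LinearMap.congr_fun h v

end Gram

/-- The homomorphism from a cell module determined by a vector killed by all diagrams of smaller
rank. -/
noncomputable def cellLift {M : Type*} [AddCommGroup M] [Module (TemperleyLieb n δ) M] (m : M)
    (hm : ∀ κ : JonesMonoid n, κ.1.rank < β.1.rank → tlBasis δ κ • m = 0) :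
    CellModule δ β →ₗ[TemperleyLieb n δ] M where
  toFun v := (cellIncl v : TemperleyLieb n δ) • m
  map_add' v w := by rw [map_add, add_smul]
  map_smul' a v := by
    have h := smul_eq_zero_of_mem_spanOf hm (cellIncl_cellProj_sub_mem a v)
    rwa [sub_smul, sub_eq_zero, mul_smul] at h

section Semisimple
variable [IsSemisimpleRing (TemperleyLieb n δ)]

theorem exists_tlBasis_smul_ne_zero {v : CellModule δ β} (hv : v ≠ 0) :
    ∃ γ : JonesMonoid n, γ.1.rank = β.1.rank ∧ tlBasis δ γ • v ≠ 0 := by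
  by_contra! hkill
  obtain ⟨y, hy⟩ := exists_mul_mul_eq_self_of_isSemisimpleRing (cellIncl v)
  have hmem : cellIncl v * y ∈ spanOf (jonesTwisting n δ) {γ | γ.1.rank ≤ β.1.rank} :=
    mul_mem_spanOf (fun α hα γ _ => (rank_mul_le_left α γ).trans (rank_eq_of_loRel_eq hα).le)
      (cellIncl_mem v) (mem_spanOf_univ y)
  have hzero : (cellIncl v * y) • v = 0 := smul_eq_zero_of_mem_spanOf
    (fun γ hγ => hγ.lt_or_eq.elim (tlBasis_smul_of_rank_lt · v) (hkill γ)) hmem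
  rw [smul_eq_cellProj, hy, cellProj_cellIncl] at hzero
  exact hv hzero

theorem exists_smul_eq_cellBasis {v : CellModule δ β} (hv : v ≠ 0) (α : LClass β) :
    ∃ a : TemperleyLieb n δ, a • v = cellBasis δ β α := by
  obtain ⟨γ, hγ, hne⟩ := exists_tlBasis_smul_ne_zero hv
  obtain ⟨κ, hκ, hκ'⟩ := exists_upRel_eq_loRel_eq hγ
  have hpair : pairing γ v ≠ 0 := fun h => hne <| by
    rw [tlBasis_smul_eq_pairing_smul (κ := ⟨κ, hκ'⟩) hκ, h, zero_smul]
  obtain ⟨η, hη, hη'⟩ := exists_upRel_eq_loRel_eq (α.rank_eq.trans hγ.symm)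
  refine ⟨(pairing γ v)⁻¹ • tlBasis δ η, ?_⟩
  rw [smul_assoc, tlBasis_smul_eq_pairing_smul hη.symm, pairing_congr hη', inv_smul_smul₀ hpair]

instance isSimpleModule_cellModule : IsSimpleModule (TemperleyLieb n δ) (CellModule δ β) := by
  refine isSimpleModule_iff_toSpanSingleton_surjective.2
    ⟨⟨cellBasis δ β ⟨β, rfl⟩, 0, (cellBasis δ β).ne_zero _⟩, fun v hv => ?_⟩
  let N : Submodule ℂ (CellModule δ β) :=
    (LinearMap.range (LinearMap.toSpanSingleton (TemperleyLieb n δ) _ v)).restrictScalars ℂ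
  have hN : ⊤ ≤ N := by
    rw [← (cellBasis δ β).span_eq, Submodule.span_le]
    rintro _ ⟨α, rfl⟩
    exact exists_smul_eq_cellBasis hv α
  exact fun w => hN (Submodule.mem_top (x := w))

theorem exists_tlBasis_self_smul_ne_zero (β : JonesMonoid n) :
    ∃ v : CellModule δ β, tlBasis δ β • v ≠ 0 := by
  obtain ⟨y, hy⟩ := exists_mul_mul_eq_self_of_isSemisimpleRing (tlBasis δ β)
  refine ⟨y • cellBasis δ β ⟨β, rfl⟩, ?_⟩
  rw [smul_smul, smul_eq_cellProj, cellIncl_cellBasis, hy, cellProj_tlBasis_of_loRel_eq rfl]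
  exact (cellBasis δ β).ne_zero _

theorem exists_tlBasis_smul_ne_zero_of_rank_eq (h : γ.1.rank = β.1.rank) :
    ∃ v : CellModule δ β, tlBasis δ γ • v ≠ 0 := by
  obtain ⟨α, hα⟩ : ∃ α : LClass γ, gram δ γ α.1 ≠ 0 := by
    by_contra! hgram
    obtain ⟨v, hv⟩ := exists_tlBasis_self_smul_ne_zero (δ := δ) γ
    have hzero : (pairing γ : CellModule δ γ →ₗ[ℂ] ℂ) = 0 := (cellBasis δ γ).ext fun α => by
      rw [pairing, Module.Basis.constr_basis, hgram, LinearMap.zero_apply]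
    apply hv
    rw [tlBasis_smul_eq_pairing_smul (κ := ⟨γ, rfl⟩) rfl, hzero, LinearMap.zero_apply, zero_smul]
  obtain ⟨κ, hκ, hκ'⟩ := exists_upRel_eq_loRel_eq h
  obtain ⟨α', hup, hlo⟩ := exists_upRel_eq_loRel_eq (α.rank_eq.trans h)
  refine ⟨cellBasis δ β ⟨α', hlo⟩, ?_⟩
  rw [tlBasis_smul_cellBasis (κ := ⟨κ, hκ'⟩) hκ, gram_congr rfl hup]
  exact smul_ne_zero hα ((cellBasis δ β).ne_zero _)

variable {M : Type*} [AddCommGroup M] [Module (TemperleyLieb n δ) M]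
  [IsSimpleModule (TemperleyLieb n δ) M]

theorem nonempty_cellModule_equiv {m : M} (hm : tlBasis δ β • m ≠ 0)
    (hlt : ∀ κ : JonesMonoid n, κ.1.rank < β.1.rank → tlBasis δ κ • m = 0) :
    Nonempty (CellModule δ β ≃ₗ[TemperleyLieb n δ] M) := by
  have hne : cellLift m hlt ≠ 0 := fun h => hm <| by
    rw [← cellIncl_cellBasis ⟨β, rfl⟩]
    exact LinearMap.congr_fun h (cellBasis δ β ⟨β, rfl⟩)
  exact ⟨LinearEquiv.ofBijective _ (LinearMap.bijective_of_ne_zero hne)⟩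

theorem nonempty_cellModule_equiv_cellModule (h : γ.1.rank = β.1.rank) :
    Nonempty (CellModule δ γ ≃ₗ[TemperleyLieb n δ] CellModule δ β) := by
  obtain ⟨v, hv⟩ := exists_tlBasis_smul_ne_zero_of_rank_eq (δ := δ) h
  exact nonempty_cellModule_equiv hv fun κ hκ => tlBasis_smul_of_rank_lt (hκ.trans_eq h) v

theorem rank_le_of_cellModule_equiv (e : CellModule δ γ ≃ₗ[TemperleyLieb n δ] CellModule δ β) :
    β.1.rank ≤ γ.1.rank := by
  obtain ⟨v, hv⟩ := exists_tlBasis_smul_ne_zero_of_rank_eq (δ := δ) (rfl : γ.1.rank = _)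
  contrapose! hv
  rw [← e.map_eq_zero_iff, map_smul, tlBasis_smul_of_rank_lt hv]

theorem rank_eq_of_cellModule_equiv (e : CellModule δ γ ≃ₗ[TemperleyLieb n δ] CellModule δ β) :
    γ.1.rank = β.1.rank :=
  (rank_le_of_cellModule_equiv e.symm).antisymm (rank_le_of_cellModule_equiv e)

variable (δ M) in
theorem exists_cellModule_equiv :
    ∃ β : JonesMonoid n, Nonempty (CellModule δ β ≃ₗ[TemperleyLieb n δ] M) := by
  have hex : ∃ β : JonesMonoid n, ∃ m : M, tlBasis δ β • m ≠ 0 := by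
    have := IsSimpleModule.nontrivial (TemperleyLieb n δ) M
    obtain ⟨m, hm⟩ := exists_ne (0 : M)
    exact ⟨1, m, by rwa [show tlBasis δ (1 : JonesMonoid n) = 1 from rfl, one_smul]⟩
  obtain ⟨β, ⟨m, hm⟩, hmin⟩ :=
    exists_minimalFor_of_wellFoundedLT _ (fun β : JonesMonoid n => β.1.rank) hex
  refine ⟨β, nonempty_cellModule_equiv hm fun κ hκ => ?_⟩
  by_contra hκm
  exact hκ.not_ge (hmin ⟨m, hκm⟩ hκ.le)

end Semisimple

theorem finrank_cellModule (δ : ℂ) (β : JonesMonoid n) :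
    Module.finrank ℂ (CellModule δ β) = (ballotPaths n β.1.rank).ncard := by
  rw [Module.finrank_eq_nat_card_basis (cellBasis δ β)]
  change {α : JonesMonoid n | loRel α = loRel β}.ncard = _
  refine Set.ncard_congr (fun α _ => upPath α) ?_ ?_ ?_
  · intro α hα
    exact rank_eq_of_loRel_eq hα ▸ upPath_mem_ballotPaths α
  · intro α κ hα hκ h
    exact ext_upRel_loRel (upPath_eq_iff.1 h) (hα.trans hκ.symm)
  · intro p hp
    have hβ := upPath_mem_ballotPaths (star β)
    rw [rank_star] at hβ
    obtain ⟨α, -, h1, h2⟩ := exists_upPath_eq hp hβ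
    exact ⟨α, upPath_eq_iff.1 h2, h1⟩

end JonesMonoid

theorem mainTheorem12 (n : ℕ) (hn : 1 ≤ n) (δ : ℂ)
    (hss : IsSemisimpleRing (TemperleyLieb n δ)) :
    ∃ (J : {r : ℕ // ∃ k : ℕ, r + 2 * k = n} → Type)
      (_ : ∀ r, AddCommGroup (J r)) (_ : ∀ r, Module ℂ (J r))
      (_ : ∀ r, Module (TemperleyLieb n δ) (J r))
      (_ : ∀ r, IsScalarTower ℂ (TemperleyLieb n δ) (J r)),
      (∀ r, IsSimpleModule (TemperleyLieb n δ) (J r)) ∧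
      (∀ r s, Nonempty (J r ≃ₗ[TemperleyLieb n δ] J s) → r = s) ∧
      (∀ (M : Type*) [AddCommGroup M] [Module (TemperleyLieb n δ) M],
        IsSimpleModule (TemperleyLieb n δ) M →
          ∃ r, Nonempty (M ≃ₗ[TemperleyLieb n δ] J r)) ∧
      (∀ r, (∀ α : JonesMonoid n, α.1.rank < r.1 → ∀ x : J r, tlBasis δ α • x = 0) ∧
        ∃ α : JonesMonoid n, α.1.rank = r.1 ∧ ∃ x : J r, tlBasis δ α • x ≠ 0) ∧
      (∀ r, ∀ k : ℕ, r.1 + 2 * k = n → 1 ≤ k →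
        Module.finrank ℂ (J r) = semigroupRank (jonesIdeal n r.1) ∧
        (semigroupRank (jonesIdeal n r.1) : ℚ)
          = ((r.1 : ℚ) + 1) / ((n : ℚ) + 1) * ((n + 1).choose k : ℚ)) := by
  choose β hβ using fun r : {r : ℕ // ∃ k : ℕ, r + 2 * k = n} =>
    r.2.elim fun _ hk => JonesMonoid.exists_rank_eq hk
  refine ⟨fun r => JonesMonoid.CellModule δ (β r), inferInstance, inferInstance, inferInstance,
    inferInstance, fun r => inferInstance, ?distinct, ?complete, fun r => ⟨?lower, ?exact⟩, ?dim⟩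
  case distinct =>
    rintro r s ⟨e⟩
    exact Subtype.ext (hβ r ▸ hβ s ▸ JonesMonoid.rank_eq_of_cellModule_equiv e)
  case complete =>
    intro M _ _ _
    obtain ⟨α, ⟨e⟩⟩ := JonesMonoid.exists_cellModule_equiv (n := n) δ M
    obtain ⟨k, hk⟩ := JonesMonoid.exists_rank_add_two_mul_eq α
    obtain ⟨e'⟩ := JonesMonoid.nonempty_cellModule_equiv_cellModule (δ := δ)
      (hβ ⟨α.1.rank, k, hk⟩).symm
    exact ⟨_, ⟨e.symm.trans e'⟩⟩
  case lower =>
    exact fun α hα => JonesMonoid.tlBasis_smul_of_rank_lt (hα.trans_eq (hβ r).symm)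
  case exact =>
    exact ⟨β r, hβ r, JonesMonoid.exists_tlBasis_smul_ne_zero_of_rank_eq rfl⟩
  case dim =>
    intro r k hk hk'
    rw [JonesMonoid.finrank_cellModule, hβ,
      JonesMonoid.semigroupRank_jonesIdeal (by omega) (by omega)]
    exact ⟨rfl, Diagram.cast_ncard_ballotPaths hk⟩
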